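/- Let $k$ be a field and let $H$ be a Hopf algebra over $k$ with bijective antipode $S$. Let $M$ be a right-left stable anti-Yetter--Drinfeld module over $H$, i.e. a right $H$-module and left $H$-comodule, with coaction $m\mapsto m_{(-1)}\otimes m_{(0)}$, such that $m_{(0)}m_{(-1)}=m$ and $(mh)_{(-1)}\otimes(mh)_{(0)}=S(h_{(3)})m_{(-1)}h_{(1)}\otimes m_{(0)}h_{(2)}$. Let $A$ be a left $H$-module algebra, let $C$ be a left $H$-module coalgebra, and let $C\otimes A\to A$, $c\otimes a\mapsto c(a)$, be a linear map with $(hc)(a)=h(c(a))$, $c(ab)=c_{(1)}(a)\,c_{(2)}(b)$ and $c(1)=\varepsilon(c)1$. Let $C^p_H(A,M)=\mathrm{Hom}_H(M\otimes A^{\otimes p+1},k)$ (for the right action $(m\otimes\tilde a)h=mh_{(1)}\otimes S(h_{(2)})\tilde a$ on $M\otimes A^{\otimes p+1}$ and the action of $H$ on $k$ by $\varepsilon$), with cofaces $$(\partial_i\varphi)(m\otimes a^0\otimes\dots\otimes a^{p+1})=\varphi(m\otimes a^0\otimes\dots\otimes a^ia^{i+1}\otimes\dots\otimes a^{p+1})\quad(0\le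 i\le p),$$ $$(\partial_{p+1}\varphi)(m\otimes a^0\otimes\dots\otimes a^{p+1})=\varphi(m_{(0)}\otimes(S^{-1}(m_{(-1)})a^{p+1})a^0\otimes a^1\otimes\dots\otimes a^p).$$ Let $C^q_H(C,M)=M\otimes_H C^{\otimes q+1}$ (diagonal action on $C^{\otimes q+1}$), with cofaces $$\partial_i(m\otimes c^0\otimes\dots\otimes c^q)=m\otimes c^0\otimes\dots\otimes\Delta(c^i)\otimes\dots\otimes c^q\quad(0\le i\le q),$$ $$\partial_{q+1}(m\otimes c^0\otimes\dots\otimes c^q)=m_{(0)}\otimes c^0_{(2)}\otimes c^1\otimes\dots\otimes c^q\otimes m_{(-1)}c^0_{(1)}.$$ Let $C^n(A)=\mathrm{Hom}(A^{\otimes n+1},k)$ with the usual Hochschild cofaces. Let $$\Psi:C^n_H(A,M)\otimes C^n_H(C,M)\to C^n(A),\qquad \Psi(\varphi\otimes(m\otimes c^0\otimes\dots\otimes c^n))(a^0\otimes\dots\otimes a^n)=\varphi(m\otimes c^0(a^0)\otimes\dots\otimes c^n(a^n)),$$ let $AW(\varphi\otimes x)=(\partial_0)^q\varphi\otimes\partial_{p+q}\cdots\partial_{q+1}x$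 be the Alexander--Whitney map $C^p_H(A,M)\otimes C^q_H(C,M)\to C^{p+q}_H(A,M)\otimes C^{p+q}_H(C,M)$, and let $\cup=\Psi\circ AW:C^p_H(A,M)\otimes C^q_H(C,M)\to C^{p+q}(A)$. Let the Hochschild cohomology of each of the three complexes be taken with respect to $b=\sum_i(-1)^i\partial_i$. Then, for all $p,q\ge 0$: 1. If $\varphi$ and $x$ are Hochschild cocycles, then so is $\varphi\cup x$, and there is a unique bilinear map on Hochschild cohomology groups, from those of $C^*_H(A,M)$ in degree $p$ and of $C^*_H(C,M)$ in degree $q$ to that of $C^*(A)$ in degree $p+q$, sending $([\varphi],[x])$ to $[\varphi\cup x]$ for all cocycles $\varphi$, $x$. 2. At the level of cochains the cup product is given by $$(\varphi\cup(m\otimes c^0\otimes\dots\otimes c^q))(a^0\otimes\dots\otimes a^{p+q})=\varphi\bigl(m_{(0)}\otimes c^0_{(p+1)}(a^0)\,c^1(a^1)\cdots c^q(a^q)\otimes (m_{(-p)}c^0_{(1)})(a^{q+1})\otimes (m_{(-p+1)}c^0_{(2)})(a^{q+2})\otimes\dots\otimes (m_{(-1)}c^0_{(p)})(a^{p+q})\bigr).$$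 3. In particular, if $m$ is coinvariant, i.e. $m_{(-1)}\otimes m_{(0)}=1\otimes m$, then $$(\varphi\cup(m\otimes c^0\otimes\dots\otimes c^q))(a^0\otimes\dots\otimes a^{p+q})=\varphi\bigl(m\otimes c^0_{(p+1)}(a^0)\,c^1(a^1)\cdots c^q(a^q)\otimes c^0_{(1)}(a^{q+1})\otimes\dots\otimes c^0_{(p)}(a^{p+q})\bigr).$$ -/

import Mathlib

open scoped TensorProduct

noncomputable section

namespace HopfCyclic

/-! ## Tensor powers: splitting off the first or the last factor -/

section TensorPowers

variable (k : Type*) [CommRing k] (V : Type*) [AddCommGroup V] [Module k V]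

/-- `V ⊗ V^{⊗n} ≃ V^{⊗(n+1)}`, `v ⊗ (v₁ ⊗ … ⊗ vₙ) ↦ v ⊗ v₁ ⊗ … ⊗ vₙ`. -/
def consE (n : ℕ) : V ⊗[k] (⨂[k]^n V) ≃ₗ[k] (⨂[k]^(n + 1) V) :=
  (TensorProduct.congr
      (PiTensorProduct.subsingletonEquiv (R := k) (s := fun _ : Fin 1 => V) (0 : Fin 1)).symm
      (LinearEquiv.refl k _)).trans
    ((TensorPower.mulEquiv (R := k) (M := V) (n := 1) (m := n)).trans
      (TensorPower.cast k V (Nat.add_comm 1 n)))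

/-- `V^{⊗n} ⊗ V ≃ V^{⊗(n+1)}`, `(v₁ ⊗ … ⊗ vₙ) ⊗ v ↦ v₁ ⊗ … ⊗ vₙ ⊗ v`. -/
def snocE (n : ℕ) : (⨂[k]^n V) ⊗[k] V ≃ₗ[k] (⨂[k]^(n + 1) V) :=
  (TensorProduct.congr (LinearEquiv.refl k _)
      (PiTensorProduct.subsingletonEquiv (R := k) (s := fun _ : Fin 1 => V) (0 : Fin 1)).symm).trans
    (TensorPower.mulEquiv (R := k) (M := V) (n := n) (m := 1))

variable {k V}

theorem consE_tprod (n : ℕ) (v : V) (w : Fin n → V) :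
    consE k V n (v ⊗ₜ PiTensorProduct.tprod k w) =
      PiTensorProduct.tprod k (Fin.cons v w : Fin (n + 1) → V) := by
  have h1 : (PiTensorProduct.subsingletonEquiv (R := k) (s := fun _ : Fin 1 => V) (0 : Fin 1)).symm v
      = PiTensorProduct.tprod k (fun _ : Fin 1 => v) := by
    rw [LinearEquiv.symm_apply_eq, PiTensorProduct.subsingletonEquiv_apply_tprod]
  simp only [consE, LinearEquiv.trans_apply, TensorProduct.congr_tmul, h1, LinearEquiv.refl_apply]
  rw [← TensorPower.gMul_def, TensorPower.tprod_mul_tprod, TensorPower.cast_tprod]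
  congr 1
  ext i
  refine Fin.cases ?_ (fun j => ?_) i
  · simp [Fin.append, Fin.addCases]
  · simp only [Fin.append, Fin.addCases, Function.comp_apply, Fin.val_cast, Fin.val_succ,
      Nat.not_lt_zero, add_lt_iff_neg_right, dite_false, Fin.cons_succ, eq_rec_constant]
    congr 1

theorem snocE_tprod (n : ℕ) (v : V) (w : Fin n → V) :
    snocE k V n (PiTensorProduct.tprod k w ⊗ₜ v) =
      PiTensorProduct.tprod k (Fin.snoc w v : Fin (n + 1) → V) := by
  have h1 : (PiTensorProduct.subsingletonEquiv (R := k) (s := fun _ : Fin 1 => V) (0 : Fin 1)).symm v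
      = PiTensorProduct.tprod k (fun _ : Fin 1 => v) := by
    rw [LinearEquiv.symm_apply_eq, PiTensorProduct.subsingletonEquiv_apply_tprod]
  simp only [snocE, LinearEquiv.trans_apply, TensorProduct.congr_tmul, h1, LinearEquiv.refl_apply]
  rw [← TensorPower.gMul_def, TensorPower.tprod_mul_tprod, show (fun _ : Fin 1 => v) = Fin.cons v Fin.elim0 from
    funext fun i => by rw [Subsingleton.elim i 0]; rfl, Fin.append_right_cons,
    Fin.append_elim0]
  rfl

theorem consE_symm_tprod (n : ℕ) (w : Fin (n + 1) → V) :
    (consE k V n).symm (PiTensorProduct.tprod k w) =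
      w 0 ⊗ₜ PiTensorProduct.tprod k (Fin.tail w) := by
  rw [LinearEquiv.symm_apply_eq, consE_tprod, Fin.cons_self_tail]

theorem snocE_symm_tprod (n : ℕ) (w : Fin (n + 1) → V) :
    (snocE k V n).symm (PiTensorProduct.tprod k w) =
      PiTensorProduct.tprod k (Fin.init w) ⊗ₜ w (Fin.last n) := by
  rw [LinearEquiv.symm_apply_eq, snocE_tprod, Fin.snoc_init_self]

end TensorPowers

/-! ## Actions on tensor products -/

section Actions

open Coalgebra HopfAlgebra TensorProduct

variable (k : Type*) [CommRing k] (H : Type*) [Ring H] [HopfAlgebra k H]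

/-- The action of a left module, as a linear map into the endomorphisms. -/
def lact (V : Type*) [AddCommGroup V] [Module k V] [Module H V] [IsScalarTower k H V] :
    H →ₗ[k] Module.End k V :=
  (Algebra.lsmul k k V).toLinearMap

/-- The action `m ↦ m h` of a right module, as a linear map into the endomorphisms. -/
def ract (M : Type*) [AddCommGroup M] [Module k M] [Module Hᵐᵒᵖ M] [IsScalarTower k Hᵐᵒᵖ M] :
    H →ₗ[k] Module.End k M :=
  (Algebra.lsmul k k M).toLinearMap ∘ₗ (MulOpposite.opLinearEquiv k).toLinearMap

variable {k H}
variable {X Y Z W : Type*} [AddCommGroup X] [Module k X] [AddCommGroup Y] [Module k Y]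
  [AddCommGroup Z] [Module k Z] [AddCommGroup W] [Module k W]

/-- `h · (x ⊗ y) = h₍₁₎ x ⊗ h₍₂₎ y`. -/
def tensorAct (f : H →ₗ[k] Module.End k X) (g : H →ₗ[k] Module.End k Y) :
    H →ₗ[k] Module.End k (X ⊗[k] Y) :=
  homTensorHomMap (RingHom.id k) X Y X Y ∘ₗ TensorProduct.map f g ∘ₗ comul

variable (k H) in
/-- The diagonal action of `H` on `V^{⊗n}`: `h · (v₁ ⊗ … ⊗ vₙ) = h₍₁₎ v₁ ⊗ … ⊗ h₍ₙ₎ vₙ`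
(through the counit for `n = 0`). -/
def act (V : Type*) [AddCommGroup V] [Module k V] [Module H V] [IsScalarTower k H V] :
    ∀ n : ℕ, H →ₗ[k] Module.End k (⨂[k]^n V)
  | 0 => (counit (R := k) (A := H)).smulRight (1 : Module.End k (⨂[k]^0 V))
  | n + 1 => ((consE k V n).conj : Module.End k (V ⊗[k] (⨂[k]^n V)) →ₗ[k] _) ∘ₗ
      tensorAct (lact k H V) (act V n)

theorem tensorAct_tmul (f : H →ₗ[k] Module.End k X) (g : H →ₗ[k] Module.End k Y) (h : H)
    (x : X) (y : Y) :
    tensorAct f g h (x ⊗ₜ y) = TensorProduct.map (f.flip x) (g.flip y) (comul h) := by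
  simp only [tensorAct, LinearMap.comp_apply]
  generalize (comul (R := k) h) = w
  induction w with
  | zero => simp
  | tmul a b => simp
  | add a b ha hb => simp only [map_add, LinearMap.add_apply, ha, hb]

theorem tensorAct_map (f : H →ₗ[k] Module.End k X) (g : H →ₗ[k] Module.End k Y)
    (f' : H →ₗ[k] Module.End k Z) (g' : H →ₗ[k] Module.End k W)
    (p : X →ₗ[k] Z) (q : Y →ₗ[k] W) (hp : ∀ h, p ∘ₗ f h = f' h ∘ₗ p)
    (hq : ∀ h, q ∘ₗ g h = g' h ∘ₗ q) (h : H) :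
    TensorProduct.map p q ∘ₗ tensorAct f g h = tensorAct f' g' h ∘ₗ TensorProduct.map p q := by
  refine TensorProduct.ext' fun x y => ?_
  simp only [LinearMap.comp_apply, tensorAct_tmul, TensorProduct.map_tmul]
  generalize (comul (R := k) h) = w
  induction w with
  | zero => simp
  | tmul a b =>
    have h1 := LinearMap.congr_fun (hp a) x
    have h2 := LinearMap.congr_fun (hq b) y
    simp only [LinearMap.comp_apply] at h1 h2
    simp [h1, h2]
  | add a b ha hb => simp only [map_add, ha, hb]

theorem tensorAct_assoc (f : H →ₗ[k] Module.End k X) (g : H →ₗ[k] Module.End k Y)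
    (l : H →ₗ[k] Module.End k Z) (h : H) :
    (TensorProduct.assoc k X Y Z).toLinearMap ∘ₗ tensorAct (tensorAct f g) l h =
      tensorAct f (tensorAct g l) h ∘ₗ (TensorProduct.assoc k X Y Z).toLinearMap := by
  refine TensorProduct.ext_threefold fun x y z => ?_
  have e1 : (tensorAct f g).flip (x ⊗ₜ y) = TensorProduct.map (f.flip x) (g.flip y) ∘ₗ comul := by
    ext; simp [tensorAct_tmul]
  have e2 : (tensorAct g l).flip (y ⊗ₜ z) = TensorProduct.map (g.flip y) (l.flip z) ∘ₗ comul := by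
    ext; simp [tensorAct_tmul]
  simp only [LinearMap.comp_apply, LinearEquiv.coe_coe, TensorProduct.assoc_tmul, tensorAct_tmul,
    e1, e2]
  have c := coassoc_apply (R := k) h
  have r1 : ∀ w : H ⊗[k] H, TensorProduct.map (TensorProduct.map (f.flip x) (g.flip y) ∘ₗ comul)
      (l.flip z) w = TensorProduct.map (TensorProduct.map (f.flip x) (g.flip y)) (l.flip z)
        (comul.rTensor H w) := fun w => by
    rw [LinearMap.map_rTensor]
  have r2 : ∀ w : H ⊗[k] H, TensorProduct.map (f.flip x)
      (TensorProduct.map (g.flip y) (l.flip z) ∘ₗ comul) w =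
      TensorProduct.map (f.flip x) (TensorProduct.map (g.flip y) (l.flip z))
        (comul.lTensor H w) := fun w => by
    rw [LinearMap.map_lTensor]
  rw [r1, r2, ← c, ← TensorProduct.map_map_assoc]

theorem tensorAct_mul (f : H →ₗ[k] Module.End k X) (g : H →ₗ[k] Module.End k Y)
    (hf : ∀ a b, f (a * b) = f a * f b) (hg : ∀ a b, g (a * b) = g a * g b) (a b : H) :
    tensorAct f g (a * b) = tensorAct f g a * tensorAct f g b := by
  simp only [tensorAct, LinearMap.comp_apply, Bialgebra.comul_mul]
  generalize (comul (R := k) a) = u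
  generalize (comul (R := k) b) = w
  induction u with
  | zero => simp
  | add u v hu hv => simp only [add_mul, map_add, hu, hv]
  | tmul a₁ a₂ =>
    induction w with
    | zero => simp
    | add u v hu hv => simp only [mul_add, map_add, hu, hv]
    | tmul b₁ b₂ =>
      refine TensorProduct.ext' fun x y => ?_
      simp [hf, hg]

variable {V : Type*} [AddCommGroup V] [Module k V] [Module H V] [IsScalarTower k H V]

@[simp] theorem lact_apply (h : H) (v : V) : lact k H V h v = h • v := rfl

theorem act_consE (n : ℕ) (h : H) :
    act k H V (n + 1) h ∘ₗ (consE k V n).toLinearMap =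
      (consE k V n).toLinearMap ∘ₗ tensorAct (lact k H V) (act k H V n) h := by
  refine LinearMap.ext fun x => ?_
  simp [act, LinearEquiv.conj_apply]

theorem act_consE_apply (n : ℕ) (h : H) (z : V ⊗[k] (⨂[k]^n V)) :
    act k H V (n + 1) h (consE k V n z) =
      consE k V n (tensorAct (lact k H V) (act k H V n) h z) := by
  have := LinearMap.congr_fun (act_consE n h) z
  simpa only [LinearMap.comp_apply, LinearEquiv.coe_coe] using this

theorem act_mul (n : ℕ) (a b : H) : act k H V n (a * b) = act k H V n a * act k H V n b := by
  induction n generalizing a b with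
  | zero => simp [act, Bialgebra.counit_mul, smul_smul, mul_comm]
  | succ n ih =>
    have := tensorAct_mul (lact k H V) (act k H V n) (fun a b => by ext; simp [mul_smul]) ih a b
    simp only [act, LinearMap.comp_apply, LinearEquiv.coe_coe, this]
    exact LinearEquiv.conj_comp _ _ _

theorem act_one (n : ℕ) : act k H V n 1 = 1 := by
  induction n with
  | zero => simp [act, Bialgebra.counit_one]
  | succ n ih =>
    have : tensorAct (lact k H V) (act k H V n) 1 = 1 := by
      refine TensorProduct.ext' fun x y => ?_
      simp [tensorAct_tmul, Bialgebra.comul_one, Algebra.TensorProduct.one_def, ih]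
    simp only [act, LinearMap.comp_apply, LinearEquiv.coe_coe, this]
    exact LinearEquiv.conj_id _

theorem snocE_consE (n : ℕ) (v w : V) (t : ⨂[k]^n V) :
    snocE k V (n + 1) (consE k V n (v ⊗ₜ t) ⊗ₜ w) =
      consE k V (n + 1) (v ⊗ₜ snocE k V n (t ⊗ₜ w)) := by
  induction t using PiTensorProduct.induction_on with
  | smul_tprod r f =>
    simp only [TensorProduct.tmul_smul, map_smul, ← TensorProduct.smul_tmul', consE_tprod,
      snocE_tprod, Fin.cons_snoc_eq_snoc_cons]
  | add x y hx hy => simp only [TensorProduct.tmul_add, TensorProduct.add_tmul, map_add, hx, hy]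

theorem tpow_zero (t : ⨂[k]^0 V) : ∃ r : k, t = r • PiTensorProduct.tprod k Fin.elim0 := by
  refine ⟨PiTensorProduct.isEmptyEquiv (Fin 0) t, ?_⟩
  apply (PiTensorProduct.isEmptyEquiv (R := k) (s := fun _ => V) (Fin 0)).injective
  simp

theorem act_snocE (n : ℕ) (h : H) :
    act k H V (n + 1) h ∘ₗ (snocE k V n).toLinearMap =
      (snocE k V n).toLinearMap ∘ₗ tensorAct (act k H V n) (lact k H V) h := by
  induction n generalizing h with
  | zero =>
    refine TensorProduct.ext' fun t v => ?_
    obtain ⟨r, rfl⟩ := tpow_zero t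
    have key : ∀ v : V, snocE k V 0 (PiTensorProduct.tprod k Fin.elim0 ⊗ₜ v) =
        consE k V 0 (v ⊗ₜ PiTensorProduct.tprod k Fin.elim0) := fun v => by
      rw [snocE_tprod, consE_tprod]
      congr 1
      ext i
      refine Fin.cases ?_ (fun j => j.elim0) i
      rfl
    have e1 := rTensor_counit_comul (R := k) h
    have e2 := lTensor_counit_comul (R := k) h
    simp only [← TensorProduct.smul_tmul', map_smul, LinearMap.comp_apply, LinearEquiv.coe_coe, key,
      act_consE_apply, tensorAct_tmul]
    congr 1
    have r1 : ∀ w : H ⊗[k] H, TensorProduct.map ((lact k H V).flip v)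
        ((act k H V 0).flip (PiTensorProduct.tprod k Fin.elim0)) w =
        TensorProduct.map ((lact k H V).flip v)
          (LinearMap.toSpanSingleton k _ (PiTensorProduct.tprod k Fin.elim0))
          (counit.lTensor H w) := fun w => by
      rw [LinearMap.map_lTensor]; congr 2
    have r2 : ∀ w : H ⊗[k] H, TensorProduct.map
        ((act k H V 0).flip (PiTensorProduct.tprod k Fin.elim0)) ((lact k H V).flip v) w =
        TensorProduct.map (LinearMap.toSpanSingleton k _ (PiTensorProduct.tprod k Fin.elim0))
          ((lact k H V).flip v) (counit.rTensor H w) := fun w => by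
      rw [LinearMap.map_rTensor]; congr 2
    rw [r1, r2, e1, e2]
    simp [key]
  | succ n ih =>
    refine TensorProduct.ext' fun t v => ?_
    obtain ⟨z, rfl⟩ := (consE k V n).surjective t
    induction z with
    | zero => simp
    | add a b ha hb => simp only [map_add, TensorProduct.add_tmul, ha, hb]
    | tmul x s =>
      have hs : ∀ z : (V ⊗[k] (⨂[k]^n V)) ⊗[k] V,
          snocE k V (n + 1) ((consE k V n).toLinearMap.rTensor V z) =
          consE k V (n + 1) ((snocE k V n).toLinearMap.lTensor V
            (TensorProduct.assoc k _ _ _ z)) := fun z => by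
        induction z with
        | zero => simp
        | add a b ha hb => simp only [map_add, ha, hb]
        | tmul a b =>
          induction a with
          | zero => simp
          | add a b ha hb => simp only [map_add, TensorProduct.add_tmul, ha, hb]
          | tmul a c => simp [snocE_consE]
      have a1 := hs ((x ⊗ₜ s) ⊗ₜ v)
      simp only [LinearMap.rTensor_tmul, LinearEquiv.coe_coe] at a1
      have a2 := tensorAct_map (tensorAct (lact k H V) (act k H V n)) (lact k H V)
        (act k H V (n + 1)) (lact k H V) (consE k V n).toLinearMap LinearMap.id
        (fun h => (act_consE n h).symm) (fun _ => rfl) h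
      have a2' := LinearMap.congr_fun a2 ((x ⊗ₜ s) ⊗ₜ v)
      have a3 := LinearMap.congr_fun (tensorAct_assoc (lact k H V) (act k H V n) (lact k H V) h)
        ((x ⊗ₜ s) ⊗ₜ v)
      have a4 := LinearMap.congr_fun (tensorAct_map (lact k H V)
        (tensorAct (act k H V n) (lact k H V)) (lact k H V) (act k H V (n + 1))
        LinearMap.id (snocE k V n).toLinearMap (fun _ => rfl) (fun h => (ih h).symm) h)
      simp only [LinearMap.comp_apply, TensorProduct.map_tmul, LinearEquiv.coe_coe,
        LinearMap.id_apply] at a2' a3 a4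
      simp only [LinearMap.comp_apply, LinearEquiv.coe_coe]
      rw [← a2', a1, act_consE_apply]
      have a5 := hs (tensorAct (tensorAct (lact k H V) (act k H V n)) (lact k H V) h
        ((x ⊗ₜ s) ⊗ₜ v))
      rw [LinearMap.rTensor] at a5
      rw [a5, a3, LinearMap.lTensor, a4, TensorProduct.assoc_tmul]

theorem act_snocE_apply (n : ℕ) (h : H) (z : (⨂[k]^n V) ⊗[k] V) :
    act k H V (n + 1) h (snocE k V n z) =
      snocE k V n (tensorAct (act k H V n) (lact k H V) h z) := by
  have := LinearMap.congr_fun (act_snocE n h) z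
  simpa only [LinearMap.comp_apply, LinearEquiv.coe_coe] using this

end Actions

end HopfCyclic

namespace HopfCyclic

open Coalgebra HopfAlgebra TensorProduct

/-! ## Hopf algebras, module (co)algebras and coefficients -/

section Structures

/-- The antipode of the Hopf algebra `H` is bijective. -/
class BijectiveAntipode (k H : Type*) [CommRing k] [Ring H] [HopfAlgebra k H] : Prop where
  bijective : Function.Bijective (antipode k : H →ₗ[k] H)

/-- The inverse `S⁻¹` of the antipode. -/
def antipodeInv (k H : Type*) [CommRing k] [Ring H] [HopfAlgebra k H] [BijectiveAntipode k H] :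
    H →ₗ[k] H :=
  (LinearEquiv.ofBijective (antipode k : H →ₗ[k] H) BijectiveAntipode.bijective).symm

/-- `C` is a left `H`-module coalgebra: `Δ(hc) = h₍₁₎c₍₁₎ ⊗ h₍₂₎c₍₂₎` and `ε(hc) = ε(h)ε(c)`. -/
class HModuleCoalgebra (k H C : Type*) [CommRing k] [Ring H] [HopfAlgebra k H]
    [AddCommGroup C] [Module k C] [Coalgebra k C] [Module H C] [IsScalarTower k H C] : Prop where
  comul_smul (h : H) (c : C) :
    comul (R := k) (h • c) = tensorAct (lact k H C) (lact k H C) h (comul (R := k) c)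
  counit_smul (h : H) (c : C) : counit (R := k) (h • c) = counit (R := k) h * counit (R := k) c

/-- `A` is a left `H`-module algebra: `h(ab) = (h₍₁₎a)(h₍₂₎b)` and `h1 = ε(h)1`. -/
class HModuleAlgebra (k H A : Type*) [CommRing k] [Ring H] [HopfAlgebra k H]
    [Ring A] [Algebra k A] [Module H A] [IsScalarTower k H A] : Prop where
  smul_mul (h : H) (a b : A) :
    h • (a * b) = LinearMap.mul' k A (tensorAct (lact k H A) (lact k H A) h (a ⊗ₜ b))
  smul_one (h : H) : h • (1 : A) = algebraMap k A (counit (R := k) h)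

/-- `x ⊗ y ⊗ z` acts on `H ⊗ M` by `g ⊗ m ↦ S(z) g x ⊗ m y`. -/
def aydMap (k H M : Type*) [CommRing k] [Ring H] [HopfAlgebra k H]
    [AddCommGroup M] [Module k M] [Module Hᵐᵒᵖ M] [IsScalarTower k Hᵐᵒᵖ M] :
    H ⊗[k] (H ⊗[k] H) →ₗ[k] Module.End k (H ⊗[k] M) :=
  homTensorHomMap (RingHom.id k) H M H M ∘ₗ
    TensorProduct.map (LinearMap.mul' k (Module.End k H) ∘ₗ
      TensorProduct.map (LinearMap.mul k H ∘ₗ antipode k) (LinearMap.mul k H).flip) (ract k H M) ∘ₗ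
    (TensorProduct.comm k H (H ⊗[k] H)).toLinearMap ∘ₗ
    (TensorProduct.assoc k H H H).toLinearMap ∘ₗ
    (TensorProduct.comm k H (H ⊗[k] H)).toLinearMap

/-- `M` is a right-left stable anti-Yetter–Drinfeld module: a right `H`-module and a left
`H`-comodule with `(mh)₍₋₁₎ ⊗ (mh)₍₀₎ = S(h₍₃₎) m₍₋₁₎ h₍₁₎ ⊗ m₍₀₎ h₍₂₎` and
`m₍₀₎ m₍₋₁₎ = m`. -/
class SAYDModule (k H M : Type*) [CommRing k] [Ring H] [HopfAlgebra k H]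
    [AddCommGroup M] [Module k M] [Module Hᵐᵒᵖ M] [IsScalarTower k Hᵐᵒᵖ M] where
  /-- The left coaction `m ↦ m₍₋₁₎ ⊗ m₍₀₎`. -/
  coact : M →ₗ[k] H ⊗[k] M
  coassoc : (TensorProduct.assoc k H H M).toLinearMap ∘ₗ (comul (R := k) (A := H)).rTensor M ∘ₗ
    coact = coact.lTensor H ∘ₗ coact
  counit_coact : (counit (R := k) (A := H)).rTensor M ∘ₗ coact = TensorProduct.mk k k M 1
  antiYetterDrinfeld (m : M) (h : H) : coact (MulOpposite.op h • m) =
    aydMap k H M ((comul (R := k) (A := H)).lTensor H (comul (R := k) h)) (coact m)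
  stable (m : M) : TensorProduct.lift (ract k H M) (coact m) = m

/-- An action `C ⊗ A → A` of an `H`-module coalgebra `C` on an `H`-module algebra `A`:
`(hc)a = h(ca)`, `c(ab) = (c₍₁₎a)(c₍₂₎b)` and `c1 = ε(c)1`. -/
class CoalgebraAction (k H C A : Type*) [CommRing k] [Ring H] [HopfAlgebra k H]
    [AddCommGroup C] [Module k C] [Coalgebra k C] [Module H C] [IsScalarTower k H C]
    [Ring A] [Algebra k A] [Module H A] [IsScalarTower k H A] where
  /-- The action `c ↦ (a ↦ c a)`. -/
  action : C →ₗ[k] A →ₗ[k] A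
  smul_action (h : H) (c : C) (a : A) : action (h • c) a = h • action c a
  action_mul (c : C) (a b : A) : action c (a * b) =
    LinearMap.mul' k A (TensorProduct.map (action.flip a) (action.flip b) (comul (R := k) c))
  action_one (c : C) : action c 1 = algebraMap k A (counit (R := k) c)

end Structures

section SweedlerIdentities

variable {k : Type*} [CommRing k] {H : Type*} [Ring H] [HopfAlgebra k H]

theorem aydMap_tmul {M : Type*} [AddCommGroup M] [Module k M] [Module Hᵐᵒᵖ M]
    [IsScalarTower k Hᵐᵒᵖ M] (x y z g : H) (m : M) :
    aydMap k H M (x ⊗ₜ (y ⊗ₜ z)) (g ⊗ₜ m) =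
      (antipode k z * g * x) ⊗ₜ (MulOpposite.op y • m) := by
  simp [aydMap, ract, mul_assoc]

/-- `y ⊗ z ↦ y₍₁₎ ⊗ y₍₂₎ S(z)`. -/
def theta (k H : Type*) [CommRing k] [Ring H] [HopfAlgebra k H] :
    H ⊗[k] H →ₗ[k] H ⊗[k] H :=
  (LinearMap.mul' k H ∘ₗ (antipode k).lTensor H).lTensor H ∘ₗ
    (TensorProduct.assoc k H H H).toLinearMap ∘ₗ (comul (R := k) (A := H)).rTensor H

theorem theta_comul (h : H) : theta k H (comul h) = h ⊗ₜ 1 := by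
  simp only [theta, LinearMap.comp_apply, LinearEquiv.coe_coe, coassoc_apply]
  rw [← LinearMap.lTensor_comp_apply, LinearMap.comp_assoc, mul_antipode_lTensor_comul,
    LinearMap.lTensor_comp_apply, lTensor_counit_comul]
  simp

theorem theta_tmul (y z : H) :
    theta k H (y ⊗ₜ z) = comul (R := k) y * (1 ⊗ₜ antipode k z) := by
  simp only [theta, LinearMap.comp_apply, LinearEquiv.coe_coe, LinearMap.rTensor_tmul]
  generalize (comul (R := k) y) = w
  induction w with
  | zero => simp
  | tmul a b => simp
  | add a b ha hb => simp only [TensorProduct.add_tmul, map_add, ha, hb, add_mul]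

variable [BijectiveAntipode k H]

@[simp] theorem antipode_antipodeInv (h : H) : antipode k (antipodeInv k H h) = h :=
  (LinearEquiv.ofBijective (antipode k : H →ₗ[k] H) BijectiveAntipode.bijective).apply_symm_apply h

@[simp] theorem antipodeInv_antipode (h : H) : antipodeInv k H (antipode k h) = h :=
  (LinearEquiv.ofBijective (antipode k : H →ₗ[k] H) BijectiveAntipode.bijective).symm_apply_apply h

theorem antipodeInv_mul (a b : H) :
    antipodeInv k H (a * b) = antipodeInv k H b * antipodeInv k H a := by
  apply (BijectiveAntipode.bijective (k := k) (H := H)).injective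
  simp [antipode_mul_antidistrib]

theorem mul_antipodeInv_comul (h : H) :
    LinearMap.mul' k H ((antipodeInv k H).lTensor H (TensorProduct.comm k H H (comul h))) =
      algebraMap k H (counit (R := k) h) := by
  apply (BijectiveAntipode.bijective (k := k) (H := H)).injective
  have : antipode k (algebraMap k H (counit (R := k) h)) = algebraMap k H (counit (R := k) h) := by
    rw [Algebra.algebraMap_eq_smul_one, map_smul, antipode_one]
  rw [this, ← mul_antipode_lTensor_comul_apply]
  generalize (comul (R := k) h) = w
  induction w with
  | zero => simp
  | tmul a b => simp [antipode_mul_antidistrib]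
  | add a b ha hb => simp only [map_add, ha, hb]

/-- `x ⊗ y ↦ y₍₁₎ S⁻¹(x) ⊗ y₍₂₎`. -/
def theta' (k H : Type*) [CommRing k] [Ring H] [HopfAlgebra k H] [BijectiveAntipode k H] :
    H ⊗[k] H →ₗ[k] H ⊗[k] H :=
  (LinearMap.mul' k H ∘ₗ (antipodeInv k H).lTensor H ∘ₗ
      (TensorProduct.comm k H H).toLinearMap).rTensor H ∘ₗ
    (TensorProduct.assoc k H H H).symm.toLinearMap ∘ₗ (comul (R := k) (A := H)).lTensor H

theorem theta'_comul (h : H) : theta' k H (comul h) = 1 ⊗ₜ h := by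
  have e : (LinearMap.mul' k H ∘ₗ (antipodeInv k H).lTensor H ∘ₗ
      (TensorProduct.comm k H H).toLinearMap) ∘ₗ comul =
      Algebra.linearMap k H ∘ₗ counit := by
    ext h; simpa using mul_antipodeInv_comul h
  simp only [theta', LinearMap.comp_apply, LinearEquiv.coe_coe, coassoc_symm_apply]
  rw [← LinearMap.rTensor_comp_apply, e, LinearMap.rTensor_comp_apply, rTensor_counit_comul]
  simp

theorem theta'_tmul (x y : H) :
    theta' k H (x ⊗ₜ y) = comul (R := k) y * (antipodeInv k H x ⊗ₜ 1) := by
  simp only [theta', LinearMap.comp_apply, LinearEquiv.coe_coe, LinearMap.lTensor_tmul]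
  generalize (comul (R := k) y) = w
  induction w with
  | zero => simp
  | tmul a b => simp
  | add a b ha hb => simp only [TensorProduct.tmul_add, map_add, ha, hb, add_mul]

end SweedlerIdentities

end HopfCyclic

namespace HopfCyclic

open Coalgebra HopfAlgebra TensorProduct

/-! ## Operators on tensor powers -/

section Operators

/-- `v₁ ⊗ … ⊗ vₙ ↦ v₁ ⊗ … ⊗ Δ(vᵢ) ⊗ … ⊗ vₙ` (positions counted from `0`). -/
def comulAt (k C : Type*) [CommRing k] [AddCommGroup C] [Module k C] [Coalgebra k C] :
    ∀ n : ℕ, Fin n → ((⨂[k]^n C) →ₗ[k] (⨂[k]^(n + 1) C))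
  | 0, i => i.elim0
  | n + 1, i => Fin.cases (motive := fun _ => (⨂[k]^(n + 1) C) →ₗ[k] (⨂[k]^(n + 1 + 1) C))
      ((consE k C (n + 1)).toLinearMap ∘ₗ (consE k C n).toLinearMap.lTensor C ∘ₗ
        (TensorProduct.assoc k C C (⨂[k]^n C)).toLinearMap ∘ₗ
        (comul (R := k) (A := C)).rTensor (⨂[k]^n C) ∘ₗ (consE k C n).symm.toLinearMap)
      (fun j => (consE k C (n + 1)).toLinearMap ∘ₗ (comulAt k C n j).lTensor C ∘ₗ
        (consE k C n).symm.toLinearMap) i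

/-- `a₁ ⊗ … ⊗ aₙ₊₁ ↦ a₁ ⊗ … ⊗ aᵢaᵢ₊₁ ⊗ … ⊗ aₙ₊₁` (positions counted from `0`). -/
def mulAt (k A : Type*) [CommRing k] [Ring A] [Algebra k A] :
    ∀ n : ℕ, Fin n → ((⨂[k]^(n + 1) A) →ₗ[k] (⨂[k]^n A))
  | 0, i => i.elim0
  | n + 1, i => Fin.cases (motive := fun _ => (⨂[k]^(n + 1 + 1) A) →ₗ[k] (⨂[k]^(n + 1) A))
      ((consE k A n).toLinearMap ∘ₗ (LinearMap.mul' k A).rTensor (⨂[k]^n A) ∘ₗ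
        (TensorProduct.assoc k A A (⨂[k]^n A)).symm.toLinearMap ∘ₗ
        (consE k A n).symm.toLinearMap.lTensor A ∘ₗ (consE k A (n + 1)).symm.toLinearMap)
      (fun j => (consE k A n).toLinearMap ∘ₗ (mulAt k A n j).lTensor A ∘ₗ
        (consE k A (n + 1)).symm.toLinearMap) i

/-- `(g ⊗ m) ⊗ (v ⊗ t) ↦ m ⊗ (f(g)v ⊗ t)`. -/
def twist {k H : Type*} [CommRing k] [Ring H] [Algebra k H] {V : Type*} [AddCommGroup V]
    [Module k V] (f : H →ₗ[k] Module.End k V) (M T : Type*) [AddCommGroup M] [Module k M]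
    [AddCommGroup T] [Module k T] :
    (H ⊗[k] M) ⊗[k] (V ⊗[k] T) →ₗ[k] M ⊗[k] (V ⊗[k] T) :=
  (TensorProduct.leftComm k V M T).toLinearMap ∘ₗ
    (TensorProduct.lift f).rTensor (M ⊗[k] T) ∘ₗ
    (TensorProduct.tensorTensorTensorComm k H M V T).toLinearMap

theorem twist_tmul {k H : Type*} [CommRing k] [Ring H] [Algebra k H] {V : Type*} [AddCommGroup V]
    [Module k V] (f : H →ₗ[k] Module.End k V) {M T : Type*} [AddCommGroup M] [Module k M]
    [AddCommGroup T] [Module k T] (g : H) (m : M) (v : V) (t : T) :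
    twist f M T ((g ⊗ₜ m) ⊗ₜ (v ⊗ₜ t)) = m ⊗ₜ (f g v ⊗ₜ t) := by
  simp [twist]

variable {k : Type*} [CommRing k] {H : Type*} [Ring H] [HopfAlgebra k H]

theorem act_consE_symm {V : Type*} [AddCommGroup V] [Module k V] [Module H V]
    [IsScalarTower k H V] (n : ℕ) (h : H) (t : ⨂[k]^(n + 1) V) :
    (consE k V n).symm (act k H V (n + 1) h t) =
      tensorAct (lact k H V) (act k H V n) h ((consE k V n).symm t) := by
  rw [LinearEquiv.symm_apply_eq, ← act_consE_apply, LinearEquiv.apply_symm_apply]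

theorem act_snocE_symm {V : Type*} [AddCommGroup V] [Module k V] [Module H V]
    [IsScalarTower k H V] (n : ℕ) (h : H) (t : ⨂[k]^(n + 1) V) :
    (snocE k V n).symm (act k H V (n + 1) h t) =
      tensorAct (act k H V n) (lact k H V) h ((snocE k V n).symm t) := by
  rw [LinearEquiv.symm_apply_eq, ← act_snocE_apply, LinearEquiv.apply_symm_apply]

theorem lTensor_tensorAct {X Y Z : Type*} [AddCommGroup X] [Module k X] [AddCommGroup Y]
    [Module k Y] [AddCommGroup Z] [Module k Z] (f : H →ₗ[k] Module.End k X)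
    (g : H →ₗ[k] Module.End k Y) (g' : H →ₗ[k] Module.End k Z) (q : Y →ₗ[k] Z)
    (hq : ∀ h y, q (g h y) = g' h (q y)) (h : H) (z : X ⊗[k] Y) :
    q.lTensor X (tensorAct f g h z) = tensorAct f g' h (q.lTensor X z) :=
  LinearMap.congr_fun (tensorAct_map f g f g' LinearMap.id q (fun _ => rfl)
    (fun h => LinearMap.ext (hq h)) h) z

theorem rTensor_tensorAct {X Y Z : Type*} [AddCommGroup X] [Module k X] [AddCommGroup Y]
    [Module k Y] [AddCommGroup Z] [Module k Z] (f : H →ₗ[k] Module.End k X)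
    (g : H →ₗ[k] Module.End k Y) (g' : H →ₗ[k] Module.End k Z) (q : Y →ₗ[k] Z)
    (hq : ∀ h y, q (g h y) = g' h (q y)) (h : H) (z : Y ⊗[k] X) :
    q.rTensor X (tensorAct g f h z) = tensorAct g' f h (q.rTensor X z) :=
  LinearMap.congr_fun (tensorAct_map g f g' f q LinearMap.id 
    (fun h => LinearMap.ext (hq h)) (fun _ => rfl) h) z

theorem assoc_tensorAct {X Y Z : Type*} [AddCommGroup X] [Module k X] [AddCommGroup Y]
    [Module k Y] [AddCommGroup Z] [Module k Z] (f : H →ₗ[k] Module.End k X)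
    (g : H →ₗ[k] Module.End k Y) (l : H →ₗ[k] Module.End k Z) (h : H) (z : (X ⊗[k] Y) ⊗[k] Z) :
    TensorProduct.assoc k X Y Z (tensorAct (tensorAct f g) l h z) =
      tensorAct f (tensorAct g l) h (TensorProduct.assoc k X Y Z z) :=
  LinearMap.congr_fun (tensorAct_assoc f g l h) z

theorem assoc_symm_tensorAct {X Y Z : Type*} [AddCommGroup X] [Module k X] [AddCommGroup Y]
    [Module k Y] [AddCommGroup Z] [Module k Z] (f : H →ₗ[k] Module.End k X)
    (g : H →ₗ[k] Module.End k Y) (l : H →ₗ[k] Module.End k Z) (h : H) (z : X ⊗[k] (Y ⊗[k] Z)) :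
    (TensorProduct.assoc k X Y Z).symm (tensorAct f (tensorAct g l) h z) =
      tensorAct (tensorAct f g) l h ((TensorProduct.assoc k X Y Z).symm z) := by
  rw [LinearEquiv.symm_apply_eq, assoc_tensorAct, LinearEquiv.apply_symm_apply]

theorem comulAt_act {C : Type*} [AddCommGroup C] [Module k C] [Coalgebra k C] [Module H C]
    [IsScalarTower k H C] [HModuleCoalgebra k H C] (n : ℕ) (i : Fin n) (h : H) (t : ⨂[k]^n C) :
    comulAt k C n i (act k H C n h t) = act k H C (n + 1) h (comulAt k C n i t) := by
  induction n generalizing h with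
  | zero => exact i.elim0
  | succ n ih =>
    refine Fin.cases ?_ (fun j => ?_) i
    · simp only [comulAt, Fin.cases_zero, LinearMap.comp_apply, LinearEquiv.coe_coe,
        act_consE_symm, act_consE_apply]
      rw [rTensor_tensorAct _ _ (tensorAct (lact k H C) (lact k H C)) _
        (fun h c => HModuleCoalgebra.comul_smul h c), assoc_tensorAct,
        lTensor_tensorAct _ _ (act k H C (n + 1)) _ (fun h y => (act_consE_apply n h y).symm)]
    · simp only [comulAt, Fin.cases_succ, LinearMap.comp_apply, LinearEquiv.coe_coe,
        act_consE_symm, act_consE_apply]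
      rw [lTensor_tensorAct _ _ (act k H C (n + 1)) _ (fun h y => ih j h y)]

theorem mulAt_act {A : Type*} [Ring A] [Algebra k A] [Module H A]
    [IsScalarTower k H A] [HModuleAlgebra k H A] (n : ℕ) (i : Fin n) (h : H)
    (t : ⨂[k]^(n + 1) A) :
    mulAt k A n i (act k H A (n + 1) h t) = act k H A n h (mulAt k A n i t) := by
  induction n generalizing h with
  | zero => exact i.elim0
  | succ n ih =>
    refine Fin.cases ?_ (fun j => ?_) i
    · have hm : ∀ (h : H) (z : A ⊗[k] A), LinearMap.mul' k A
          (tensorAct (lact k H A) (lact k H A) h z) = lact k H A h (LinearMap.mul' k A z) := by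
        intro h z
        induction z with
        | zero => simp
        | tmul a b => exact (HModuleAlgebra.smul_mul h a b).symm
        | add a b ha hb => simp only [map_add, ha, hb]
      simp only [mulAt, Fin.cases_zero, LinearMap.comp_apply, LinearEquiv.coe_coe,
        act_consE_symm, act_consE_apply]
      rw [lTensor_tensorAct _ _ (tensorAct (lact k H A) (act k H A n)) _
        (fun h y => act_consE_symm n h y), assoc_symm_tensorAct, 
        rTensor_tensorAct _ _ (lact k H A) _ hm]
    · simp only [mulAt, Fin.cases_succ, LinearMap.comp_apply, LinearEquiv.coe_coe,
        act_consE_symm, act_consE_apply]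
      rw [lTensor_tensorAct _ _ (act k H A n) _ (fun h y => ih j h y)]

end Operators

/-! ## The complex of a module coalgebra -/

section CoalgebraComplex

variable (k H M C : Type*) [CommRing k] [Ring H] [HopfAlgebra k H]
  [AddCommGroup M] [Module k M] [Module Hᵐᵒᵖ M] [IsScalarTower k Hᵐᵒᵖ M]
  [AddCommGroup C] [Module k C] [Module H C] [IsScalarTower k H C]

/-- The relations `mh ⊗ t = m ⊗ ht` in `M ⊗ C^{⊗n}`. -/
def balancedRel (n : ℕ) : Submodule k (M ⊗[k] (⨂[k]^n C)) :=
  Submodule.span k {z | ∃ (m : M) (h : H) (t : ⨂[k]^n C),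
    z = (MulOpposite.op h • m) ⊗ₜ[k] t - m ⊗ₜ[k] act k H C n h t}

/-- `Cⁿ_H(C, M) = M ⊗_H C^{⊗(n+1)}`, for the diagonal action of `H` on `C^{⊗(n+1)}`. -/
abbrev CochC (n : ℕ) : Type _ := (M ⊗[k] (⨂[k]^(n + 1) C)) ⧸ balancedRel k H M C (n + 1)

variable {k H M C}

theorem balancedRel_le {N : Type*} [AddCommGroup N] [Module k N] {n : ℕ}
    (f : M ⊗[k] (⨂[k]^n C) →ₗ[k] N) (P : Submodule k N)
    (hf : ∀ (m : M) (h : H) (t : ⨂[k]^n C),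
      f ((MulOpposite.op h • m) ⊗ₜ[k] t) - f (m ⊗ₜ[k] act k H C n h t) ∈ P) :
    balancedRel k H M C n ≤ P.comap f := by
  refine Submodule.span_le.2 ?_
  rintro z ⟨m, h, t, rfl⟩
  simpa using hf m h t

theorem balanced_mk {n : ℕ} (m : M) (h : H) (t : ⨂[k]^n C) :
    (balancedRel k H M C n).mkQ ((MulOpposite.op h • m) ⊗ₜ[k] t) =
      (balancedRel k H M C n).mkQ (m ⊗ₜ[k] act k H C n h t) := by
  simp only [Submodule.mkQ_apply]
  exact (Submodule.Quotient.eq _).2 (Submodule.subset_span ⟨m, h, t, rfl⟩)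

variable [SAYDModule k H M]

variable (k H M C) in
/-- `m ⊗ c⁰ ⊗ … ⊗ cⁿ ↦ m₍₀₎ ⊗ c¹ ⊗ … ⊗ cⁿ ⊗ m₍₋₁₎c⁰` before passing to `⊗_H`. -/
def preTauC (n : ℕ) : M ⊗[k] (⨂[k]^(n + 1) C) →ₗ[k] M ⊗[k] (⨂[k]^(n + 1) C) :=
  ((snocE k C n).toLinearMap ∘ₗ (TensorProduct.comm k C (⨂[k]^n C)).toLinearMap).lTensor M ∘ₗ
    twist (lact k H C) M (⨂[k]^n C) ∘ₗ
    TensorProduct.map (SAYDModule.coact (k := k) (H := H) (M := M)) (consE k C n).symm.toLinearMap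

theorem preTauC_aux (n : ℕ) (h : H) (u : H ⊗[k] M) (c : C) (t : ⨂[k]^n C) :
    (balancedRel k H M C (n + 1)).mkQ
      (((snocE k C n).toLinearMap ∘ₗ (TensorProduct.comm k C (⨂[k]^n C)).toLinearMap).lTensor M
        (twist (lact k H C) M (⨂[k]^n C)
          ((aydMap k H M ((comul (R := k) (A := H)).lTensor H (comul (R := k) h)) u) ⊗ₜ
            (c ⊗ₜ t)))) =
    (balancedRel k H M C (n + 1)).mkQ
      (((snocE k C n).toLinearMap ∘ₗ (TensorProduct.comm k C (⨂[k]^n C)).toLinearMap).lTensor M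
        (twist (lact k H C) M (⨂[k]^n C)
          (u ⊗ₜ tensorAct (lact k H C) (act k H C n) h (c ⊗ₜ t)))) := by
  induction u with
  | zero => simp
  | add u v hu hv => simp only [map_add, TensorProduct.add_tmul, hu, hv]
  | tmul g m =>
    -- `Ψ (x ⊗ (a ⊗ b)) = m ⊗ (a t ⊗ b g x c)`
    let Ψ : H ⊗[k] (H ⊗[k] H) →ₗ[k] M ⊗[k] (⨂[k]^(n + 1) C) :=
      TensorProduct.mk k M _ m ∘ₗ (snocE k C n).toLinearMap ∘ₗ
        TensorProduct.map ((act k H C n).flip t)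
          ((lact k H C).flip c ∘ₗ LinearMap.mul' k H ∘ₗ (LinearMap.mulLeft k g).lTensor H) ∘ₗ
        (TensorProduct.assoc k H H H).toLinearMap ∘ₗ
        (TensorProduct.comm k H (H ⊗[k] H)).toLinearMap
    have hΨ : ∀ x a b : H, Ψ (x ⊗ₜ (a ⊗ₜ b)) =
        m ⊗ₜ snocE k C n (act k H C n a t ⊗ₜ ((b * (g * x)) • c)) := by
      intro x a b
      simp [Ψ]
    have h1 : ∀ w : H ⊗[k] (H ⊗[k] H), (balancedRel k H M C (n + 1)).mkQ
      (((snocE k C n).toLinearMap ∘ₗ (TensorProduct.comm k C (⨂[k]^n C)).toLinearMap).lTensor M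
        (twist (lact k H C) M (⨂[k]^n C)
          ((aydMap k H M w (g ⊗ₜ m)) ⊗ₜ (c ⊗ₜ t)))) =
        (balancedRel k H M C (n + 1)).mkQ (Ψ ((theta k H).lTensor H w)) := by
      intro w
      induction w with
      | zero => simp
      | add u v hu hv =>
        simp only [map_add, LinearMap.add_apply, TensorProduct.add_tmul, hu, hv]
      | tmul x w =>
        induction w with
        | zero => simp
        | add u v hu hv =>
          simp only [map_add, TensorProduct.tmul_add, LinearMap.add_apply, TensorProduct.add_tmul,
            hu, hv]
        | tmul y z =>
          rw [aydMap_tmul, twist_tmul]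
          simp only [LinearMap.lTensor_tmul, LinearMap.comp_apply, LinearEquiv.coe_coe,
            TensorProduct.comm_tmul]
          rw [balanced_mk, act_snocE_apply, tensorAct_tmul, theta_tmul]
          congr 1
          generalize (comul (R := k) y) = w
          induction w with
          | zero => simp
          | add u v hu hv =>
            simp only [map_add, TensorProduct.tmul_add, add_mul, hu, hv]
          | tmul a b =>
            simp [hΨ, mul_smul]
    rw [h1, ← LinearMap.lTensor_comp_apply]
    have h2 : theta k H ∘ₗ comul = (TensorProduct.mk k H H).flip 1 := by
      ext h; simp [theta_comul]
    rw [h2]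
    congr 1
    rw [tensorAct_tmul]
    generalize (comul (R := k) h) = w
    induction w with
    | zero => simp
    | add u v hu hv => simp only [map_add, TensorProduct.tmul_add, hu, hv]
    | tmul a b =>
      rw [LinearMap.lTensor_tmul, LinearMap.flip_apply, TensorProduct.mk_apply, hΨ,
        TensorProduct.map_tmul, twist_tmul]
      simp [mul_smul]

theorem preTauC_le (n : ℕ) : balancedRel k H M C (n + 1) ≤
    (balancedRel k H M C (n + 1)).comap (preTauC k H M C n) := by
  refine balancedRel_le _ _ fun m h t => ?_
  rw [← (Submodule.Quotient.eq _), ← Submodule.mkQ_apply, ← Submodule.mkQ_apply]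
  simp only [preTauC, LinearMap.comp_apply, TensorProduct.map_tmul, LinearEquiv.coe_coe,
    act_consE_symm, SAYDModule.antiYetterDrinfeld]
  generalize (consE k C n).symm t = z
  induction z with
  | zero => simp
  | add u v hu hv => simp only [map_add, TensorProduct.tmul_add, hu, hv]
  | tmul c t => exact preTauC_aux n h _ c t

variable (k H M C) in
/-- The cyclic operator `τ(m ⊗_H c⁰ ⊗ … ⊗ cⁿ) = m₍₀₎ ⊗_H c¹ ⊗ … ⊗ cⁿ ⊗ m₍₋₁₎c⁰`. -/
def tauC (n : ℕ) : CochC k H M C n →ₗ[k] CochC k H M C n :=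
  Submodule.mapQ _ _ (preTauC k H M C n) (preTauC_le n)

variable [Coalgebra k C] [HModuleCoalgebra k H C]

theorem comulAt_le (n : ℕ) (i : Fin n) : balancedRel k H M C n ≤
    (balancedRel k H M C (n + 1)).comap ((comulAt k C n i).lTensor M) := by
  refine balancedRel_le _ _ fun m h t => ?_
  rw [LinearMap.lTensor_tmul, LinearMap.lTensor_tmul, comulAt_act]
  exact Submodule.subset_span ⟨m, h, _, rfl⟩

variable (k H M C) in
/-- `∂ᵢ(m ⊗_H c⁰ ⊗ … ⊗ cⁿ) = m ⊗_H c⁰ ⊗ … ⊗ Δ(cⁱ) ⊗ … ⊗ cⁿ`, `0 ≤ i ≤ n`. -/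
def innerFaceC (n : ℕ) (i : Fin (n + 1)) : CochC k H M C n →ₗ[k] CochC k H M C (n + 1) :=
  Submodule.mapQ _ _ ((comulAt k C (n + 1) i).lTensor M) (comulAt_le (n + 1) i)

variable (k H M C) in
/-- The last coface `∂ₙ₊₁ = τ ∂₀`, i.e.
`∂ₙ₊₁(m ⊗_H c⁰ ⊗ … ⊗ cⁿ) = m₍₀₎ ⊗_H c⁰₍₂₎ ⊗ c¹ ⊗ … ⊗ cⁿ ⊗ m₍₋₁₎c⁰₍₁₎`. -/
def lastFaceC (n : ℕ) : CochC k H M C n →ₗ[k] CochC k H M C (n + 1) :=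
  tauC k H M C (n + 1) ∘ₗ innerFaceC k H M C n 0

variable (k H M C) in
/-- The cofaces `∂₀, …, ∂ₙ₊₁` of `C^*_H(C, M)`. -/
def faceC (n : ℕ) (i : Fin (n + 2)) : CochC k H M C n →ₗ[k] CochC k H M C (n + 1) :=
  Fin.lastCases (motive := fun _ => CochC k H M C n →ₗ[k] CochC k H M C (n + 1))
    (lastFaceC k H M C n) (innerFaceC k H M C n) i

end CoalgebraComplex
end HopfCyclic

namespace HopfCyclic

open Coalgebra HopfAlgebra TensorProduct
/-! ## The complex of a module algebra -/

section AlgebraComplex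

variable (k H M A : Type*) [CommRing k] [Ring H] [HopfAlgebra k H]
  [AddCommGroup M] [Module k M] [Module Hᵐᵒᵖ M] [IsScalarTower k Hᵐᵒᵖ M]
  [Ring A] [Algebra k A] [Module H A] [IsScalarTower k H A]

/-- The diagonal right action of `H` on `M ⊗ A^{⊗n}`: `(m ⊗ t) h = m h₍₁₎ ⊗ S(h₍₂₎) t`. -/
def diagR (n : ℕ) : H →ₗ[k] Module.End k (M ⊗[k] (⨂[k]^n A)) :=
  tensorAct (ract k H M) (act k H A n ∘ₗ antipode k)

/-- The `H`-linear functionals on `M ⊗ A^{⊗(n+1)}`, where `H` acts on `k` through the counit. -/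
def homH (n : ℕ) : Submodule k (M ⊗[k] (⨂[k]^(n + 1) A) →ₗ[k] k) where
  carrier := {φ | ∀ (h : H) (z : M ⊗[k] (⨂[k]^(n + 1) A)),
    φ (diagR k H M A (n + 1) h z) = counit (R := k) h * φ z}
  add_mem' {φ ψ} h1 h2 h z := by simp [h1 h z, h2 h z, mul_add]
  zero_mem' h z := by simp
  smul_mem' r φ h1 h z := by simp [h1 h z, mul_left_comm]

/-- `Cⁿ_H(A, M) = Hom_H(M ⊗ A^{⊗(n+1)}, k)`. -/
def CochA (n : ℕ) : Type _ := homH k H M A n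

instance (n : ℕ) : AddCommGroup (CochA k H M A n) :=
  inferInstanceAs (AddCommGroup (homH k H M A n))

instance (n : ℕ) : Module k (CochA k H M A n) :=
  inferInstanceAs (Module k (homH k H M A n))

variable {k H M A}

/-- The linear functional underlying an element of `Cⁿ_H(A, M)`. -/
def CochA.form {n : ℕ} : CochA k H M A n →ₗ[k] M ⊗[k] (⨂[k]^(n + 1) A) →ₗ[k] k :=
  (homH k H M A n).subtype

theorem mem_homH_iff {n : ℕ} {φ : M ⊗[k] (⨂[k]^(n + 1) A) →ₗ[k] k} :
    φ ∈ homH k H M A n ↔ ∀ (m : M) (h : H) (t : ⨂[k]^(n + 1) A),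
      φ ((MulOpposite.op h • m) ⊗ₜ t) = φ (m ⊗ₜ act k H A (n + 1) h t) := by
  constructor
  · intro hφ m h t
    -- both sides of `φ ((m ⊗ h₍₂₎ t) h₍₁₎) = ε(h₍₁₎) φ (m ⊗ h₍₂₎ t)`
    let F : H ⊗[k] H →ₗ[k] k := φ ∘ₗ TensorProduct.map ((ract k H M).flip m)
      ((act k H A (n + 1)).flip t)
    have h1 : ∀ w : H ⊗[k] H,
        F ((LinearMap.mul' k H ∘ₗ (antipode k).rTensor H).lTensor H
          (TensorProduct.assoc k H H H (comul.rTensor H w))) =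
        φ (m ⊗ₜ act k H A (n + 1) (TensorProduct.lid k H (counit.rTensor H w)) t) := by
      intro w
      induction w with
      | zero => simp
      | add u v hu hv => simp only [map_add, hu, hv, LinearMap.add_apply, TensorProduct.tmul_add]
      | tmul x y =>
        have := hφ x (m ⊗ₜ act k H A (n + 1) y t)
        rw [diagR, tensorAct_tmul] at this
        simp only [LinearMap.rTensor_tmul, TensorProduct.lid_tmul, map_smul, LinearMap.smul_apply,
          TensorProduct.tmul_smul, smul_eq_mul]
        rw [← this]
        generalize (comul (R := k) x) = w
        induction w with
        | zero => simp
        | add u v hu hv => simp only [map_add, TensorProduct.add_tmul, hu, hv]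
        | tmul a b => simp [F, act_mul]
    have h2 := h1 (comul h)
    rw [coassoc_apply, rTensor_counit_comul, ← LinearMap.lTensor_comp_apply, LinearMap.comp_assoc,
      mul_antipode_rTensor_comul, LinearMap.lTensor_comp_apply, lTensor_counit_comul] at h2
    simpa [F, act_one, ract] using h2
  · intro hφ h z
    induction z with
    | zero => simp
    | add u v hu hv => simp only [map_add, hu, hv, mul_add]
    | tmul m t =>
      have h1 : ∀ w : H ⊗[k] H, φ (TensorProduct.map ((ract k H M).flip m)
          ((act k H A (n + 1) ∘ₗ antipode k).flip t) w) =
          φ (m ⊗ₜ act k H A (n + 1) (LinearMap.mul' k H ((antipode k).lTensor H w)) t) := by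
        intro w
        induction w with
        | zero => simp
        | add u v hu hv =>
          simp only [map_add, hu, hv, LinearMap.add_apply, TensorProduct.tmul_add]
        | tmul a b => simpa [ract, act_mul] using hφ m a (act k H A (n + 1) (antipode k b) t)
      rw [diagR, tensorAct_tmul, h1, mul_antipode_lTensor_comul_apply,
        Algebra.algebraMap_eq_smul_one]
      simp [act_one]

variable [SAYDModule k H M] [BijectiveAntipode k H]

variable (k H M A) in
/-- `m ⊗ a⁰ ⊗ … ⊗ aⁿ ↦ m₍₀₎ ⊗ S⁻¹(m₍₋₁₎)aⁿ ⊗ a⁰ ⊗ … ⊗ aⁿ⁻¹`. -/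
def preTauA (n : ℕ) : M ⊗[k] (⨂[k]^(n + 1) A) →ₗ[k] M ⊗[k] (⨂[k]^(n + 1) A) :=
  (consE k A n).toLinearMap.lTensor M ∘ₗ
    twist (lact k H A ∘ₗ antipodeInv k H) M (⨂[k]^n A) ∘ₗ
    TensorProduct.map (SAYDModule.coact (k := k) (H := H) (M := M))
      ((TensorProduct.comm k (⨂[k]^n A) A).toLinearMap ∘ₗ (snocE k A n).symm.toLinearMap)

theorem preTauA_aux {n : ℕ} {φ : M ⊗[k] (⨂[k]^(n + 1) A) →ₗ[k] k} (hφ : φ ∈ homH k H M A n)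
    (h : H) (u : H ⊗[k] M) (a : A) (t : ⨂[k]^n A) :
    φ ((consE k A n).toLinearMap.lTensor M
        (twist (lact k H A ∘ₗ antipodeInv k H) M (⨂[k]^n A)
          ((aydMap k H M ((comul (R := k) (A := H)).lTensor H (comul (R := k) h)) u) ⊗ₜ
            (a ⊗ₜ t)))) =
    φ ((consE k A n).toLinearMap.lTensor M
        (twist (lact k H A ∘ₗ antipodeInv k H) M (⨂[k]^n A)
          (u ⊗ₜ TensorProduct.comm k (⨂[k]^n A) A
            (tensorAct (act k H A n) (lact k H A) h (t ⊗ₜ a))))) := by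
  rw [mem_homH_iff] at hφ
  induction u with
  | zero => simp
  | add u v hu hv => simp only [map_add, TensorProduct.add_tmul, hu, hv]
  | tmul g m =>
    -- `Ψ ((x ⊗ y) ⊗ z) = φ (m ⊗ x S⁻¹(g) z a ⊗ y t)`
    let Ψ : (H ⊗[k] H) ⊗[k] H →ₗ[k] k :=
      φ ∘ₗ TensorProduct.mk k M _ m ∘ₗ (consE k A n).toLinearMap ∘ₗ
        TensorProduct.map ((lact k H A).flip a ∘ₗ LinearMap.mul' k H ∘ₗ
            (LinearMap.mulLeft k (antipodeInv k H g)).lTensor H) ((act k H A n).flip t) ∘ₗ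
        (TensorProduct.assoc k H H H).symm.toLinearMap ∘ₗ
        (TensorProduct.comm k H H).toLinearMap.lTensor H ∘ₗ
        (TensorProduct.assoc k H H H).toLinearMap
    have hΨ : ∀ x y z : H, Ψ ((x ⊗ₜ y) ⊗ₜ z) =
        φ (m ⊗ₜ consE k A n (((x * (antipodeInv k H g * z)) • a) ⊗ₜ act k H A n y t)) := by
      intro x y z
      simp [Ψ]
    have h1 : ∀ w : H ⊗[k] (H ⊗[k] H),
        φ ((consE k A n).toLinearMap.lTensor M
        (twist (lact k H A ∘ₗ antipodeInv k H) M (⨂[k]^n A)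
          ((aydMap k H M w (g ⊗ₜ m)) ⊗ₜ (a ⊗ₜ t)))) =
        Ψ ((theta' k H).rTensor H ((TensorProduct.assoc k H H H).symm w)) := by
      intro w
      induction w with
      | zero => simp
      | add u v hu hv =>
        simp only [map_add, LinearMap.add_apply, TensorProduct.add_tmul, hu, hv]
      | tmul x w =>
        induction w with
        | zero => simp
        | add u v hu hv =>
          simp only [map_add, TensorProduct.tmul_add, LinearMap.add_apply, TensorProduct.add_tmul,
            hu, hv]
        | tmul y z =>
          rw [aydMap_tmul, twist_tmul]
          simp only [LinearMap.lTensor_tmul, LinearMap.comp_apply, LinearEquiv.coe_coe,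
            TensorProduct.assoc_symm_tmul, LinearMap.rTensor_tmul]
          rw [hφ, act_consE_apply, tensorAct_tmul, theta'_tmul]
          generalize (comul (R := k) y) = w
          induction w with
          | zero => simp
          | add u v hu hv =>
            simp only [map_add, TensorProduct.tmul_add, TensorProduct.add_tmul, add_mul, hu, hv]
          | tmul b c =>
            rw [Algebra.TensorProduct.tmul_mul_tmul, hΨ]
            simp [mul_smul, antipodeInv_mul]
    rw [h1, coassoc_symm_apply, ← LinearMap.rTensor_comp_apply]
    have h2 : theta' k H ∘ₗ comul = TensorProduct.mk k H H 1 := by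
      ext h; simp [theta'_comul]
    rw [h2, tensorAct_tmul]
    generalize (comul (R := k) h) = w
    induction w with
    | zero => simp
    | add u v hu hv => simp only [map_add, TensorProduct.tmul_add, hu, hv]
    | tmul b c =>
      rw [LinearMap.rTensor_tmul, TensorProduct.mk_apply, hΨ,
        TensorProduct.map_tmul, TensorProduct.comm_tmul, twist_tmul]
      simp [mul_smul]

theorem preTauA_mem {n : ℕ} {φ : M ⊗[k] (⨂[k]^(n + 1) A) →ₗ[k] k} (hφ : φ ∈ homH k H M A n) :
    φ ∘ₗ preTauA k H M A n ∈ homH k H M A n := by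
  rw [mem_homH_iff]
  intro m h t
  simp only [preTauA, LinearMap.comp_apply, TensorProduct.map_tmul, LinearEquiv.coe_coe,
    act_snocE_symm, SAYDModule.antiYetterDrinfeld]
  generalize (snocE k A n).symm t = z
  induction z with
  | zero => simp
  | add u v hu hv => simp only [map_add, TensorProduct.tmul_add, hu, hv]
  | tmul t a => exact preTauA_aux hφ h _ a t

variable (k H M A) in
/-- The cyclic operator
`(τφ)(m ⊗ a⁰ ⊗ … ⊗ aⁿ) = φ(m₍₀₎ ⊗ S⁻¹(m₍₋₁₎)aⁿ ⊗ a⁰ ⊗ … ⊗ aⁿ⁻¹)`. -/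
def tauA (n : ℕ) : CochA k H M A n →ₗ[k] CochA k H M A n :=
  LinearMap.restrict (LinearMap.lcomp k k (preTauA k H M A n)) fun _ hφ => preTauA_mem hφ

variable [HModuleAlgebra k H A]

theorem mulAt_mem {n : ℕ} (i : Fin (n + 1)) {φ : M ⊗[k] (⨂[k]^(n + 1) A) →ₗ[k] k}
    (hφ : φ ∈ homH k H M A n) :
    φ ∘ₗ (mulAt k A (n + 1) i).lTensor M ∈ homH k H M A (n + 1) := by
  rw [mem_homH_iff] at hφ ⊢
  intro m h t
  simp only [LinearMap.comp_apply, LinearMap.lTensor_tmul]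
  rw [hφ, mulAt_act]

variable (k H M A) in
/-- `(∂ᵢφ)(m ⊗ a⁰ ⊗ … ⊗ aⁿ⁺¹) = φ(m ⊗ a⁰ ⊗ … ⊗ aⁱaⁱ⁺¹ ⊗ … ⊗ aⁿ⁺¹)`, `0 ≤ i ≤ n`. -/
def innerFaceA (n : ℕ) (i : Fin (n + 1)) : CochA k H M A n →ₗ[k] CochA k H M A (n + 1) :=
  LinearMap.restrict (LinearMap.lcomp k k ((mulAt k A (n + 1) i).lTensor M))
    fun _ hφ => mulAt_mem i hφ

variable (k H M A) in
/-- The last coface `∂ₙ₊₁ = τ ∂₀`, i.e.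
`(∂ₙ₊₁φ)(m ⊗ a⁰ ⊗ … ⊗ aⁿ⁺¹) = φ(m₍₀₎ ⊗ (S⁻¹(m₍₋₁₎)aⁿ⁺¹)a⁰ ⊗ a¹ ⊗ … ⊗ aⁿ)`. -/
def lastFaceA (n : ℕ) : CochA k H M A n →ₗ[k] CochA k H M A (n + 1) :=
  tauA k H M A (n + 1) ∘ₗ innerFaceA k H M A n 0

variable (k H M A) in
/-- The cofaces `∂₀, …, ∂ₙ₊₁` of `C^*_H(A, M)`. -/
def faceA (n : ℕ) (i : Fin (n + 2)) : CochA k H M A n →ₗ[k] CochA k H M A (n + 1) :=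
  Fin.lastCases (motive := fun _ => CochA k H M A n →ₗ[k] CochA k H M A (n + 1))
    (lastFaceA k H M A n) (innerFaceA k H M A n) i

end AlgebraComplex

/-! ## The Hochschild complex of an algebra -/

section Hochschild

variable (k A : Type*) [CommRing k] [Ring A] [Algebra k A]

/-- `Cⁿ(A) = Hom(A^{⊗(n+1)}, k)`. -/
abbrev Coch (n : ℕ) : Type _ := (⨂[k]^(n + 1) A) →ₗ[k] k

/-- `a⁰ ⊗ … ⊗ aⁿ ↦ aⁿ ⊗ a⁰ ⊗ … ⊗ aⁿ⁻¹`. -/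
def rot (n : ℕ) : (⨂[k]^(n + 1) A) →ₗ[k] (⨂[k]^(n + 1) A) :=
  (consE k A n).toLinearMap ∘ₗ (TensorProduct.comm k (⨂[k]^n A) A).toLinearMap ∘ₗ
    (snocE k A n).symm.toLinearMap

/-- The Hochschild cofaces: for `i ≤ n`,
`(∂ᵢφ)(a⁰ ⊗ … ⊗ aⁿ⁺¹) = φ(a⁰ ⊗ … ⊗ aⁱaⁱ⁺¹ ⊗ … ⊗ aⁿ⁺¹)`, and
`(∂ₙ₊₁φ)(a⁰ ⊗ … ⊗ aⁿ⁺¹) = φ(aⁿ⁺¹a⁰ ⊗ a¹ ⊗ … ⊗ aⁿ)`. -/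
def face (n : ℕ) (i : Fin (n + 2)) : Coch k A n →ₗ[k] Coch k A (n + 1) :=
  Fin.lastCases (motive := fun _ => Coch k A n →ₗ[k] Coch k A (n + 1))
    (LinearMap.lcomp k k (mulAt k A (n + 1) 0 ∘ₗ rot k A (n + 1)))
    (fun i => LinearMap.lcomp k k (mulAt k A (n + 1) i)) i

end Hochschild

/-! ## Hochschild cohomology of a sequence of modules with cofaces -/

section Cohomology

variable {k : Type*} [CommRing k] {X : ℕ → Type*} [∀ n, AddCommGroup (X n)] [∀ n, Module k (X n)]

/-- The Hochschild coboundary `b = ∑ᵢ (-1)ⁱ ∂ᵢ`. -/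
def hochB (d : ∀ n, Fin (n + 2) → (X n →ₗ[k] X (n + 1))) (n : ℕ) : X n →ₗ[k] X (n + 1) :=
  ∑ i : Fin (n + 2), (-1 : k) ^ (i : ℕ) • d n i

/-- The Hochschild cocycles of degree `n`. -/
def cocycles (d : ∀ n, Fin (n + 2) → (X n →ₗ[k] X (n + 1))) (n : ℕ) : Submodule k (X n) :=
  LinearMap.ker (hochB d n)

/-- The Hochschild coboundaries of degree `n`. -/
def coboundaries (d : ∀ n, Fin (n + 2) → (X n →ₗ[k] X (n + 1))) : ∀ n : ℕ, Submodule k (X n)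
  | 0 => ⊥
  | n + 1 => LinearMap.range (hochB d n)

/-- Hochschild cohomology: cocycles modulo coboundaries. -/
abbrev HochCohomology (d : ∀ n, Fin (n + 2) → (X n →ₗ[k] X (n + 1))) (n : ℕ) : Type _ :=
  cocycles d n ⧸ (coboundaries d n).comap (cocycles d n).subtype

/-- The composite `X n → X (n+1) → … → X m` of a sequence of maps `X j → X (j+1)`. -/
def iterTo (d : ∀ n, X n →ₗ[k] X (n + 1)) {n m : ℕ} (h : n ≤ m) : X n →ₗ[k] X m :=
  Nat.leRec (motive := fun m _ => X n →ₗ[k] X m) LinearMap.id (fun m _ f => d m ∘ₗ f) h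

end Cohomology
end HopfCyclic

namespace HopfCyclic

open Coalgebra HopfAlgebra TensorProduct

/-! ## The cup product -/

section CupProduct

variable (k H M C A : Type*) [CommRing k] [Ring H] [HopfAlgebra k H]
  [AddCommGroup M] [Module k M] [Module Hᵐᵒᵖ M] [IsScalarTower k Hᵐᵒᵖ M]
  [AddCommGroup C] [Module k C] [Module H C] [IsScalarTower k H C]
  [Ring A] [Algebra k A] [Module H A] [IsScalarTower k H A]

/-- `f⁰ ⊗ … ⊗ fⁿ⁻¹` applied to `c⁰ ⊗ … ⊗ cⁿ⁻¹`, for `H`-linear maps `fⁱ : C → A`, is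
`f⁰(c⁰) ⊗ … ⊗ fⁿ⁻¹(cⁿ⁻¹)`. -/
def evalHom (n : ℕ) : (⨂[k]^n (C →ₗ[H] A)) →ₗ[k] (⨂[k]^n C) →ₗ[k] (⨂[k]^n A) :=
  PiTensorProduct.piTensorHomMap ∘ₗ
    PiTensorProduct.map (fun _ => LinearMap.restrictScalarsₗ k H C A k)

variable {k H M C A}

theorem evalHom_act (n : ℕ) (f : ⨂[k]^n (C →ₗ[H] A)) (h : H) (t : ⨂[k]^n C) :
    evalHom k H C A n f (act k H C n h t) = act k H A n h (evalHom k H C A n f t) := by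
  induction f using PiTensorProduct.induction_on with
  | add x y hx hy => simp only [map_add, LinearMap.add_apply, hx, hy]
  | smul_tprod r f =>
    simp only [map_smul, LinearMap.smul_apply]
    congr 1
    induction n generalizing h with
    | zero => simp [act]
    | succ n ih =>
      have key : ∀ z : C ⊗[k] (⨂[k]^n C),
          evalHom k H C A (n + 1) (PiTensorProduct.tprod k f) (consE k C n z) =
          consE k A n (TensorProduct.map ((f 0).restrictScalars k)
            (evalHom k H C A n (PiTensorProduct.tprod k (Fin.tail f))) z) := by
        intro z
        induction z with
        | zero => simp
        | add u v hu hv => simp only [map_add, hu, hv]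
        | tmul c t =>
          induction t using PiTensorProduct.induction_on with
          | add x y hx hy => simp only [map_add, TensorProduct.tmul_add, hx, hy]
          | smul_tprod r c' =>
            simp only [map_smul, TensorProduct.tmul_smul]
            congr 1
            rw [consE_tprod, TensorProduct.map_tmul]
            simp only [evalHom, LinearMap.comp_apply, PiTensorProduct.map_tprod,
              PiTensorProduct.piTensorHomMap_tprod_tprod, consE_tprod]
            congr 1
            ext i
            refine Fin.cases ?_ (fun j => ?_) i <;> simp [Fin.tail]
      obtain ⟨z, rfl⟩ := (consE k C n).surjective t
      rw [act_consE_apply, key, key, act_consE_apply]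
      congr 1
      exact LinearMap.congr_fun (tensorAct_map (lact k H C) (act k H C n) (lact k H A)
        (act k H A n) ((f 0).restrictScalars k) _ (fun h => by ext; simp)
        (fun h => LinearMap.ext fun t => ih h t (Fin.tail f)) h) z

theorem pairC_le (n : ℕ) (φ : CochA k H M A n) (f : ⨂[k]^(n + 1) (C →ₗ[H] A)) :
    balancedRel k H M C (n + 1) ≤
      LinearMap.ker (CochA.form φ ∘ₗ (evalHom k H C A (n + 1) f).lTensor M) := by
  refine Submodule.span_le.2 ?_
  rintro z ⟨m, h, t, rfl⟩
  rw [SetLike.mem_coe, LinearMap.mem_ker, map_sub, sub_eq_zero]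
  simp only [LinearMap.comp_apply, LinearMap.lTensor_tmul, evalHom_act]
  exact mem_homH_iff.1 φ.2 m h _

variable (k H M C A) in
/-- `(φ, f) ↦ (m ⊗_H t ↦ φ(m ⊗ f(t)))`. -/
def pairC (n : ℕ) : CochA k H M A n →ₗ[k] (⨂[k]^(n + 1) (C →ₗ[H] A)) →ₗ[k]
    CochC k H M C n →ₗ[k] k :=
  LinearMap.mk₂ k
    (fun φ f => Submodule.liftQ (balancedRel k H M C (n + 1))
      (CochA.form φ ∘ₗ (evalHom k H C A (n + 1) f).lTensor M) (pairC_le n φ f))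
    (fun φ ψ f => Submodule.linearMap_qext _ (LinearMap.ext fun z => by simp))
    (fun r φ f => Submodule.linearMap_qext _ (LinearMap.ext fun z => by simp))
    (fun φ f g => Submodule.linearMap_qext _ (LinearMap.ext fun z => by simp [LinearMap.lTensor_add]))
    (fun r φ f => Submodule.linearMap_qext _ (LinearMap.ext fun z => by simp [LinearMap.lTensor_smul]))

variable (k H M C A) in
/-- `Ψ_c(φ ⊗ (m ⊗_H c⁰ ⊗ … ⊗ cⁿ))(f⁰ ⊗ … ⊗ fⁿ) = φ(m ⊗ f⁰(c⁰) ⊗ … ⊗ fⁿ(cⁿ))`, with values in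
the `n`-cochains on `Hom_H(C, A)`. -/
def psiC (n : ℕ) : CochA k H M A n ⊗[k] CochC k H M C n →ₗ[k]
    (⨂[k]^(n + 1) (C →ₗ[H] A)) →ₗ[k] k :=
  TensorProduct.lift (LinearMap.lflip.toLinearMap ∘ₗ pairC k H M C A n)

variable [Coalgebra k C] [CoalgebraAction k H C A]

variable (k H C A) in
/-- The map `A → Hom_H(C, A)`, `a ↦ (c ↦ c a)`. -/
def natMap : A →ₗ[k] (C →ₗ[H] A) where
  toFun a :=
    { toFun := fun c => CoalgebraAction.action (k := k) (H := H) c a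
      map_add' := fun c d => by simp
      map_smul' := fun h c => CoalgebraAction.smul_action h c a }
  map_add' a b := by ext; simp
  map_smul' r a := by ext; simp

variable (k H M C A) in
/-- `Ψ(φ ⊗ (m ⊗_H c⁰ ⊗ … ⊗ cⁿ))(a⁰ ⊗ … ⊗ aⁿ) = φ(m ⊗ c⁰(a⁰) ⊗ … ⊗ cⁿ(aⁿ))`, the composite of
`Ψ_c` with the restriction along `A → Hom_H(C, A)`. -/
def psi (n : ℕ) : CochA k H M A n ⊗[k] CochC k H M C n →ₗ[k] Coch k A n :=
  LinearMap.lcomp k k (PiTensorProduct.map (fun _ => natMap k H C A)) ∘ₗ psiC k H M C A n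

variable [SAYDModule k H M] [BijectiveAntipode k H] [HModuleCoalgebra k H C] [HModuleAlgebra k H A]

variable (k H M C A) in
/-- The Alexander–Whitney map from bidegree `(p, q)` of the bicosimplicial module
`C^*_H(A, M) ⊗ C^*_H(C, M)` to its diagonal:
`φ ⊗ x ↦ (∂₀)^q φ ⊗ ∂_{p+q} ⋯ ∂_{q+1} x`. -/
def alexanderWhitney (p q : ℕ) : CochA k H M A p ⊗[k] CochC k H M C q →ₗ[k]
    CochA k H M A (p + q) ⊗[k] CochC k H M C (p + q) :=
  TensorProduct.map
    (iterTo (X := fun n => CochA k H M A n) (fun n => faceA k H M A n 0) (Nat.le_add_right p q))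
    (iterTo (X := fun n => CochC k H M C n) (fun n => faceC k H M C n (Fin.last (n + 1)))
      (Nat.le_add_left q p))

variable (k H M C A) in
/-- The cup product `∪ = Ψ ∘ AW` on cochains. -/
def cup (p q : ℕ) : CochA k H M A p →ₗ[k] CochC k H M C q →ₗ[k] Coch k A (p + q) :=
  TensorProduct.curry (psi k H M C A (p + q) ∘ₗ alexanderWhitney k H M C A p q)

/-! The three Hochschild complexes: cocycles and Hochschild cohomology groups. -/

variable (k H M A) in
/-- Hochschild cocycles of `C^*_H(A, M)`. -/
abbrev cocyclesA (n : ℕ) : Submodule k (CochA k H M A n) :=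
  cocycles (X := fun n => CochA k H M A n) (faceA k H M A) n

variable (k H M C) in
/-- Hochschild cocycles of `C^*_H(C, M)`. -/
abbrev cocyclesC (n : ℕ) : Submodule k (CochC k H M C n) :=
  cocycles (X := fun n => CochC k H M C n) (faceC k H M C) n

variable (k A) in
/-- Hochschild cocycles of `C^*(A)`. -/
abbrev hochCocycles (n : ℕ) : Submodule k (Coch k A n) :=
  cocycles (X := fun n => Coch k A n) (face k A) n

variable (k H M A) in
/-- Hochschild cohomology of `C^*_H(A, M)`. -/
abbrev HHA (n : ℕ) : Type _ := HochCohomology (X := fun n => CochA k H M A n) (faceA k H M A) n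

variable (k H M C) in
/-- Hochschild cohomology of `C^*_H(C, M)`. -/
abbrev HHC (n : ℕ) : Type _ := HochCohomology (X := fun n => CochC k H M C n) (faceC k H M C) n

variable (k A) in
/-- Hochschild cohomology of `C^*(A)`. -/
abbrev HH (n : ℕ) : Type _ := HochCohomology (X := fun n => Coch k A n) (face k A) n

variable (k H M A) in
/-- The class in Hochschild cohomology of a cocycle of `C^*_H(A, M)`. -/
def classA (n : ℕ) : cocyclesA k H M A n →ₗ[k] HHA k H M A n :=
  Submodule.mkQ _

variable (k H M C) in
/-- The class in Hochschild cohomology of a cocycle of `C^*_H(C, M)`. -/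
def classC (n : ℕ) : cocyclesC k H M C n →ₗ[k] HHC k H M C n :=
  Submodule.mkQ _

variable (k A) in
/-- The class in Hochschild cohomology of a cocycle of `C^*(A)`. -/
def classHH (n : ℕ) : hochCocycles k A n →ₗ[k] HH k A n :=
  Submodule.mkQ _

variable (k H M C) in
/-- The class `m ⊗_H c⁰ ⊗ … ⊗ cⁿ` in `M ⊗_H C^{⊗(n+1)}`. -/
def tensC (n : ℕ) (m : M) (c : Fin (n + 1) → C) : CochC k H M C n :=
  (balancedRel k H M C (n + 1)).mkQ (m ⊗ₜ[k] PiTensorProduct.tprod k c)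

end CupProduct

/-! ## Iterated comultiplication and coaction -/

section Iterated

/-- `c ↦ c₍₁₎ ⊗ … ⊗ c₍ₙ₊₁₎`. -/
def comulIter (k C : Type*) [CommRing k] [AddCommGroup C] [Module k C] [Coalgebra k C] :
    ∀ n : ℕ, C →ₗ[k] (⨂[k]^(n + 1) C)
  | 0 => (consE k C 0).toLinearMap ∘ₗ
      (TensorProduct.mk k C (⨂[k]^0 C)).flip (PiTensorProduct.tprod k Fin.elim0)
  | n + 1 => (consE k C (n + 1)).toLinearMap ∘ₗ (comulIter k C n).lTensor C ∘ₗ comul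

/-- `m ↦ m₍₋ₙ₎ ⊗ … ⊗ m₍₋₁₎ ⊗ m₍₀₎`. -/
def coactIter (k H M : Type*) [CommRing k] [Ring H] [HopfAlgebra k H]
    [AddCommGroup M] [Module k M] [Module Hᵐᵒᵖ M] [IsScalarTower k Hᵐᵒᵖ M] [SAYDModule k H M] :
    ∀ n : ℕ, M →ₗ[k] (⨂[k]^n H) ⊗[k] M
  | 0 => TensorProduct.mk k (⨂[k]^0 H) M (PiTensorProduct.tprod k Fin.elim0)
  | n + 1 => (consE k H n).toLinearMap.rTensor M ∘ₗ
      (TensorProduct.assoc k H (⨂[k]^n H) M).symm.toLinearMap ∘ₗ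
      (coactIter k H M n).lTensor H ∘ₗ SAYDModule.coact (k := k) (H := H) (M := M)

end Iterated
end HopfCyclic

end

/-!
The proof rests on the cosimplicial structure of the three complexes. The cup product is the
composite of a degreewise pairing `Ψ` with the Alexander–Whitney map, so it is enough that `Ψ`
commutes with all cofaces, `Ψ(∂ᵢφ ⊗ ∂ᵢx) = ∂ᵢΨ(φ ⊗ x)`, and that the first coface of `C^*_H(A, M)`
and the last coface of `C^*_H(C, M)` satisfy the relations `∂_{i+1}∂₀ = ∂₀∂ᵢ` and
`∂ᵢ∂_{n+1} = ∂_{n+2}∂ᵢ`. From these alone follows the Leibniz rule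
`b(φ ∪ x) = φ ∪ b x + (-1)^q b φ ∪ x` (`hochB_pairCup`), hence a well-defined product on cohomology;
uniqueness is the surjectivity of the map from cocycles to classes
(`existsUnique_cohomology_pairCup`).

The relations (`faceA_succ_faceA_zero`, `faceC_castSucc_faceC_last`) come from associativity of `A`,
and from coassociativity of `C` and `M`. In `psi_faceA_faceC` the inner cofaces match because
`c(ab) = c₍₁₎(a) c₍₂₎(b)`. For the last ones `m₍₋₁₎` occurs twice, once through `S⁻¹` acting on `A` and
once acting on `C`, and the two cancel by `S⁻¹(h₍₂₎) h₍₁₎ = ε(h)` (`antipodeInvAct_coact`).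

The explicit formula is obtained by computing the two iterated cofaces separately: `(∂₀)^q`
multiplies the first `q + 1` factors (`iterTo_faceA_zero_form`), and `∂_{p+q} ⋯ ∂_{q+1}` splits off
`p` components of `c⁰` and of `m` (`iterTo_faceC_last_mk`). For a coinvariant `m` the iterated
coaction of `m` is `1 ⊗ … ⊗ 1 ⊗ m`.
-/

namespace HopfCyclic

open Coalgebra HopfAlgebra TensorProduct

/-! ### Pairings of sequences of modules with cofaces -/

section FacePairing

variable {k : Type*} [CommRing k] {X Y Z : ℕ → Type*}
  [∀ n, AddCommGroup (X n)] [∀ n, Module k (X n)]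
  [∀ n, AddCommGroup (Y n)] [∀ n, Module k (Y n)]
  [∀ n, AddCommGroup (Z n)] [∀ n, Module k (Z n)]

theorem iterTo_self (d : ∀ n, X n →ₗ[k] X (n + 1)) (n : ℕ) (x : X n) :
    iterTo d (le_refl n) x = x := by
  simp [iterTo]

theorem iterTo_succ (d : ∀ n, X n →ₗ[k] X (n + 1)) {n m : ℕ} (h : n ≤ m) (h' : n ≤ m + 1)
    (x : X n) : iterTo d h' x = d m (iterTo d h x) := by
  simp [iterTo, Nat.leRec_succ _ _ h]

theorem iterTo_comp_self (d : ∀ n, X n →ₗ[k] X (n + 1)) {n m : ℕ} (h : n + 1 ≤ m) (h' : n ≤ m)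
    (x : X n) : iterTo d h (d n x) = iterTo d h' x := by
  induction m, h using Nat.le_induction with
  | base => rw [iterTo_self, iterTo_succ d (le_refl n), iterTo_self]
  | succ m h ih => rw [iterTo_succ d h, iterTo_succ d (by omega), ih]

section First

variable (dX : ∀ n, Fin (n + 2) → (X n →ₗ[k] X (n + 1)))

/-- `∂ᵢ (∂₀)^q x = (∂₀)^{q+1} x` for `i ≤ q`. -/
theorem face_iterTo_first_of_le
    (hX : ∀ n (i : Fin (n + 2)) (x : X n), dX (n + 1) i.succ (dX n 0 x) = dX (n + 1) 0 (dX n i x))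
    {p q n : ℕ} (hn : n = p + q) (h : p ≤ n) (h' : p ≤ n + 1) (i : Fin (n + 2)) (hi : (i : ℕ) ≤ q)
    (x : X p) :
    dX n i (iterTo (fun n => dX n 0) h x) = iterTo (fun n => dX n 0) h' x := by
  induction q generalizing n with
  | zero =>
    obtain rfl : i = 0 := Fin.ext (by simpa using hi)
    rw [iterTo_succ _ h]
  | succ q ih =>
    obtain ⟨n, rfl⟩ : ∃ m, n = m + 1 := ⟨p + q, hn⟩
    refine Fin.cases (fun _ => ?_) (fun i hi => ?_) i hi
    · rw [iterTo_succ _ h]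
    · rw [iterTo_succ _ (show p ≤ n by omega) h, hX,
        ih (by omega) (by omega) h i (by simpa using hi), iterTo_succ _ h]

/-- `∂_{j+q} (∂₀)^q x = (∂₀)^q ∂ⱼ x`. -/
theorem face_iterTo_first
    (hX : ∀ n (i : Fin (n + 2)) (x : X n), dX (n + 1) i.succ (dX n 0 x) = dX (n + 1) 0 (dX n i x))
    {p q n : ℕ} (hn : n = p + q) (h : p ≤ n) (h' : p + 1 ≤ n + 1) (i : Fin (n + 2))
    (j : Fin (p + 2)) (hi : (i : ℕ) = j + q) (x : X p) :
    dX n i (iterTo (fun n => dX n 0) h x) = iterTo (fun n => dX n 0) h' (dX p j x) := by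
  induction q generalizing n with
  | zero =>
    obtain rfl : n = p := hn
    obtain rfl : i = j := Fin.ext hi
    rw [iterTo_self, iterTo_self]
  | succ q ih =>
    obtain ⟨n, rfl⟩ : ∃ m, n = m + 1 := ⟨p + q, hn⟩
    obtain ⟨i, rfl⟩ : ∃ i' : Fin (n + 2), i = i'.succ :=
      ⟨i.pred (fun h0 => by simp [h0] at hi), by simp⟩
    rw [iterTo_succ _ (show p ≤ n by omega) h, hX,
      ih (by omega) (by omega) (by omega) i (by simp only [Fin.val_succ] at hi; omega),
      iterTo_succ _ (show p + 1 ≤ n + 1 by omega) h']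

end First

section Last

variable (dY : ∀ n, Fin (n + 2) → (Y n →ₗ[k] Y (n + 1)))

/-- Iterated last cofaces commute with `∂ᵢ` for `i ≤ q + 1`. -/
theorem face_iterTo_last
    (hY : ∀ n (i : Fin (n + 2)) (y : Y n),
      dY (n + 1) i.castSucc (dY n (Fin.last _) y) = dY (n + 1) (Fin.last _) (dY n i y))
    {p q n : ℕ} (hn : n = q + p) (h : q ≤ n) (h' : q + 1 ≤ n + 1) (i : Fin (n + 2))
    (j : Fin (q + 2)) (hi : (i : ℕ) = j) (y : Y q) :
    dY n i (iterTo (fun n => dY n (Fin.last _)) h y) =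
      iterTo (fun n => dY n (Fin.last _)) h' (dY q j y) := by
  induction p generalizing n with
  | zero =>
    obtain rfl : n = q := hn
    obtain rfl : i = j := Fin.ext hi
    rw [iterTo_self, iterTo_self]
  | succ p ih =>
    obtain ⟨n, rfl⟩ : ∃ m, n = m + 1 := ⟨q + p, hn⟩
    obtain ⟨i, rfl⟩ : ∃ i' : Fin (n + 2), i = i'.castSucc :=
      ⟨⟨i, by omega⟩, rfl⟩
    rw [iterTo_succ _ (show q ≤ n by omega) h, hY,
      ih (by omega) (by omega) (by omega) i hi,
      iterTo_succ _ (show q + 1 ≤ n + 1 by omega) h']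

/-- On an iterate of last cofaces of an element of degree `q`, all `∂ᵢ` with `i > q` agree with the
last coface. -/
theorem face_iterTo_last_of_lt
    (hY : ∀ n (i : Fin (n + 2)) (y : Y n),
      dY (n + 1) i.castSucc (dY n (Fin.last _) y) = dY (n + 1) (Fin.last _) (dY n i y))
    {p q n : ℕ} (hn : n = q + p) (h : q ≤ n) (h' : q ≤ n + 1) (i : Fin (n + 2))
    (hi : q < (i : ℕ)) (y : Y q) :
    dY n i (iterTo (fun n => dY n (Fin.last _)) h y) =
      iterTo (fun n => dY n (Fin.last _)) h' y := by
  induction p generalizing n with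
  | zero =>
    obtain rfl : n = q := hn
    obtain rfl : i = Fin.last _ := Fin.ext (by simp only [Fin.val_last]; omega)
    rw [iterTo_succ _ h]
  | succ p ih =>
    obtain ⟨n, rfl⟩ : ∃ m, n = m + 1 := ⟨q + p, hn⟩
    refine Fin.lastCases (fun _ => ?_) (fun i hi => ?_) i hi
    · rw [iterTo_succ _ h]
    · rw [iterTo_succ _ (show q ≤ n by omega) h, hY,
        ih (by omega) (by omega) h i (by simpa using hi), iterTo_succ _ h]

end Last

variable {dX : ∀ n, Fin (n + 2) → (X n →ₗ[k] X (n + 1))}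
  {dY : ∀ n, Fin (n + 2) → (Y n →ₗ[k] Y (n + 1))}
  {dZ : ∀ n, Fin (n + 2) → (Z n →ₗ[k] Z (n + 1))}

variable (dX dY) in
/-- The cup product of a degreewise pairing `P`: `(x, y) ↦ P((∂₀)^{n-p} x, ∂ₙ ⋯ ∂_{q+1} y)`. The target
degree `n` is a parameter of its own, so that degrees such as `(p + 1) + q` and `(p + q) + 1` need
not be identified by a transport. -/
def pairCup (P : ∀ n, X n →ₗ[k] Y n →ₗ[k] Z n) {p q n : ℕ} (hp : p ≤ n) (hq : q ≤ n) :
    X p →ₗ[k] Y q →ₗ[k] Z n :=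
  (P n).compl₁₂ (iterTo (fun n => dX n 0) hp) (iterTo (fun n => dY n (Fin.last _)) hq)

variable (hX : ∀ n (i : Fin (n + 2)) (x : X n),
    dX (n + 1) i.succ (dX n 0 x) = dX (n + 1) 0 (dX n i x))
  (hY : ∀ n (i : Fin (n + 2)) (y : Y n),
    dY (n + 1) i.castSucc (dY n (Fin.last _) y) = dY (n + 1) (Fin.last _) (dY n i y))
  {P : ∀ n, X n →ₗ[k] Y n →ₗ[k] Z n}
  (hP : ∀ n (i : Fin (n + 2)) (x : X n) (y : Y n),
    P (n + 1) (dX n i x) (dY n i y) = dZ n i (P n x y))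

include hX hY hP in
/-- The Leibniz rule `b(x ∪ y) = x ∪ b y + (-1)^q b x ∪ y`. In the coboundary of the cup product the
cofaces `∂ᵢ` with `i ≤ q` only act on `y` and those with `i > q` only on `x`; the remaining terms
`∂_{q+1} y` and `∂₀ x` on the right-hand side cancel. -/
theorem hochB_pairCup {p q n : ℕ} (hn : n = p + q) (hp : p ≤ n) (hq : q ≤ n)
    (hp₀ : p ≤ n + 1) (hq₀ : q ≤ n + 1) (hp₁ : p + 1 ≤ n + 1) (hq₁ : q + 1 ≤ n + 1)
    (x : X p) (y : Y q) :
    hochB dZ n (pairCup dX dY P hp hq x y) =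
      pairCup dX dY P hp₀ hq₁ x (hochB dY q y) +
        (-1 : k) ^ q • pairCup dX dY P hp₁ hq₀ (hochB dX p x) y := by
  have e : (q + 1) + (p + 1) = n + 2 := by omega
  have h1 : hochB dZ n (pairCup dX dY P hp hq x y) =
      ∑ i : Fin ((q + 1) + (p + 1)), (-1 : k) ^ (i : ℕ) •
        dZ n (Fin.cast e i) (pairCup dX dY P hp hq x y) := by
    simp only [hochB, LinearMap.sum_apply, LinearMap.smul_apply]
    exact (Fintype.sum_equiv (finCongr e) _ _ fun i => rfl).symm
  have low : ∀ i : Fin (q + 1), dZ n (Fin.cast e (Fin.castAdd (p + 1) i))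
      (pairCup dX dY P hp hq x y) = pairCup dX dY P hp₀ hq₁ x (dY q i.castSucc y) := by
    intro i
    rw [pairCup, LinearMap.compl₁₂_apply, ← hP,
      face_iterTo_first_of_le dX hX hn hp hp₀ _ (by simp; omega),
      face_iterTo_last (p := p) dY hY (by omega) hq hq₁ _ i.castSucc rfl]
    rfl
  have high : ∀ j : Fin (p + 1), dZ n (Fin.cast e (Fin.natAdd (q + 1) j))
      (pairCup dX dY P hp hq x y) = pairCup dX dY P hp₁ hq₀ (dX p j.succ x) y := by
    intro j
    rw [pairCup, LinearMap.compl₁₂_apply, ← hP,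
      face_iterTo_first dX hX hn hp hp₁ _ j.succ (by simp; omega),
      face_iterTo_last_of_lt (p := p) dY hY (by omega) hq hq₀ _ (by simp; omega)]
    rfl
  have boundary : pairCup dX dY P hp₀ hq₁ x (dY q (Fin.last _) y) =
      pairCup dX dY P hp₁ hq₀ (dX p 0 x) y := by
    simp only [pairCup, LinearMap.compl₁₂_apply]
    rw [iterTo_comp_self (fun n => dY n (Fin.last _)) hq₁ hq₀,
      iterTo_comp_self (fun n => dX n 0) hp₁ hp₀]
  rw [h1, Fin.sum_univ_add]
  simp only [low, high]
  simp only [hochB, LinearMap.sum_apply, LinearMap.smul_apply, map_sum, map_smul]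
  rw [Fin.sum_univ_castSucc (n := q + 1), Fin.sum_univ_succ (n := p + 1), boundary]
  have shift : ∀ T : Fin (p + 1) → Z (n + 1),
      ∑ j : Fin (p + 1), (-1 : k) ^ (q + 1 + (j : ℕ)) • T j =
        (-1 : k) ^ q • ∑ j : Fin (p + 1), (-1 : k) ^ ((j : ℕ) + 1) • T j := by
    intro T
    rw [Finset.smul_sum]
    refine Finset.sum_congr rfl fun j _ => ?_
    rw [smul_smul, ← pow_add, add_assoc, add_comm 1]
  simp only [Fin.val_castAdd, Fin.val_natAdd, Fin.val_castSucc, Fin.val_last, Fin.val_succ,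
    Fin.val_zero, pow_zero, one_smul, smul_add, shift]
  rw [pow_succ (-1 : k) q, mul_neg_one, neg_smul]
  abel

include hX hY hP in
theorem pairCup_mem_cocycles {p q n : ℕ} (hn : n = p + q) (hp : p ≤ n) (hq : q ≤ n)
    {x : X p} (hx : x ∈ cocycles dX p) {y : Y q} (hy : y ∈ cocycles dY q) :
    pairCup dX dY P hp hq x y ∈ cocycles dZ n := by
  rw [cocycles, LinearMap.mem_ker] at *
  rw [hochB_pairCup hX hY hP hn hp hq (by omega) (by omega) (by omega) (by omega), hx, hy]
  simp

include hX hY hP in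
theorem pairCup_mem_coboundaries_left {p q n : ℕ} (hn : n = p + q) (hp : p ≤ n) (hq : q ≤ n)
    {x : X p} (hx : x ∈ coboundaries dX p) {y : Y q} (hy : y ∈ cocycles dY q) :
    pairCup dX dY P hp hq x y ∈ coboundaries dZ n := by
  cases p with
  | zero =>
    obtain rfl : x = 0 := hx
    simp
  | succ p =>
    obtain ⟨n, rfl⟩ : ∃ m, n = m + 1 := ⟨p + q, by omega⟩
    obtain ⟨w, rfl⟩ := hx
    rw [cocycles, LinearMap.mem_ker] at hy
    refine ⟨(-1 : k) ^ q • pairCup dX dY P (show p ≤ n by omega) (show q ≤ n by omega) w y, ?_⟩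
    rw [map_smul, hochB_pairCup hX hY hP (by omega) _ _ (by omega) hq hp (by omega), hy, map_zero,
      zero_add, smul_smul, ← mul_pow]
    simp

include hX hY hP in
theorem pairCup_mem_coboundaries_right {p q n : ℕ} (hn : n = p + q) (hp : p ≤ n) (hq : q ≤ n)
    {x : X p} (hx : x ∈ cocycles dX p) {y : Y q} (hy : y ∈ coboundaries dY q) :
    pairCup dX dY P hp hq x y ∈ coboundaries dZ n := by
  cases q with
  | zero =>
    obtain rfl : y = 0 := hy
    simp
  | succ q =>
    obtain ⟨n, rfl⟩ : ∃ m, n = m + 1 := ⟨p + q, by omega⟩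
    obtain ⟨w, rfl⟩ := hy
    rw [cocycles, LinearMap.mem_ker] at hx
    refine ⟨pairCup dX dY P (show p ≤ n by omega) (show q ≤ n by omega) x w, ?_⟩
    rw [hochB_pairCup hX hY hP (by omega) _ _ hp (by omega) (by omega) hq, hx]
    simp

include hX hY hP in
theorem existsUnique_cohomology_pairCup {p q n : ℕ} (hn : n = p + q) (hp : p ≤ n) (hq : q ≤ n) :
    ∃! cupH : HochCohomology dX p →ₗ[k] HochCohomology dY q →ₗ[k] HochCohomology dZ n,
      ∀ (x : cocycles dX p) (y : cocycles dY q),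
        ∃ h : pairCup dX dY P hp hq x y ∈ cocycles dZ n,
          cupH (Submodule.mkQ _ x) (Submodule.mkQ _ y) = Submodule.mkQ _ ⟨_, h⟩ := by
  let B : cocycles dX p →ₗ[k] cocycles dY q →ₗ[k] HochCohomology dZ n :=
    LinearMap.mk₂ k
      (fun x y => Submodule.mkQ _ ⟨pairCup dX dY P hp hq x y,
        pairCup_mem_cocycles hX hY hP hn hp hq x.2 y.2⟩)
      (fun x x' y => by rw [← map_add]; congr 1; ext; simp)
      (fun r x y => by rw [← map_smul]; congr 1; ext; simp)
      (fun x y y' => by rw [← map_add]; congr 1; ext; simp)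
      (fun r x y => by rw [← map_smul]; congr 1; ext; simp)
  have hB : ∀ x y, B x y = Submodule.mkQ _ ⟨pairCup dX dY P hp hq x y,
        pairCup_mem_cocycles hX hY hP hn hp hq x.2 y.2⟩ := fun _ _ => rfl
  have right : ∀ x, (coboundaries dY q).comap (cocycles dY q).subtype ≤ LinearMap.ker (B x) := by
    intro x y hy
    rw [LinearMap.mem_ker, hB, Submodule.mkQ_apply, Submodule.Quotient.mk_eq_zero]
    exact pairCup_mem_coboundaries_right hX hY hP hn hp hq x.2 hy
  let B' : cocycles dX p →ₗ[k] HochCohomology dY q →ₗ[k] HochCohomology dZ n :=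
    { toFun := fun x => Submodule.liftQ _ (B x) (right x)
      map_add' := fun x x' => Submodule.linearMap_qext _ (LinearMap.ext fun y => by simp)
      map_smul' := fun r x => Submodule.linearMap_qext _ (LinearMap.ext fun y => by simp) }
  have left : (coboundaries dX p).comap (cocycles dX p).subtype ≤ LinearMap.ker B' := by
    intro x hx
    rw [LinearMap.mem_ker]
    refine Submodule.linearMap_qext _ (LinearMap.ext fun y => ?_)
    change B x y = 0
    rw [hB, Submodule.mkQ_apply, Submodule.Quotient.mk_eq_zero]
    exact pairCup_mem_coboundaries_left hX hY hP hn hp hq hx y.2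
  refine ⟨Submodule.liftQ _ B' left, fun x y =>
    ⟨pairCup_mem_cocycles hX hY hP hn hp hq x.2 y.2, rfl⟩, fun F hF => ?_⟩
  refine Submodule.linearMap_qext _ (LinearMap.ext fun x =>
    Submodule.linearMap_qext _ (LinearMap.ext fun y => ?_))
  obtain ⟨h, e⟩ := hF x y
  exact e

end FacePairing

/-! ### Inner cofaces on tensors with a split factor -/

section SplitFactors

variable {k : Type*} [CommRing k]

section Induction

variable {V : Type*} [AddCommGroup V] [Module k V]

@[elab_as_elim]
theorem consE_induction {n : ℕ} {p : (⨂[k]^(n + 1) V) → Prop}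
    (cons : ∀ v t, p (consE k V n (v ⊗ₜ t))) (add : ∀ x y, p x → p y → p (x + y)) (t) : p t := by
  obtain ⟨z, rfl⟩ := (consE k V n).surjective t
  induction z with
  | zero => simpa using cons 0 0
  | tmul v t => exact cons v t
  | add x y hx hy => rw [map_add]; exact add _ _ hx hy

@[elab_as_elim]
theorem snocE_induction {n : ℕ} {p : (⨂[k]^(n + 1) V) → Prop}
    (snoc : ∀ t v, p (snocE k V n (t ⊗ₜ v))) (add : ∀ x y, p x → p y → p (x + y)) (t) : p t := by
  obtain ⟨z, rfl⟩ := (snocE k V n).surjective t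
  induction z with
  | zero => simpa using snoc 0 0
  | tmul t v => exact snoc t v
  | add x y hx hy => rw [map_add]; exact add _ _ hx hy

theorem snocE_zero (t : ⨂[k]^0 V) (v : V) :
    snocE k V 0 (t ⊗ₜ v) = consE k V 0 (v ⊗ₜ t) := by
  obtain ⟨r, rfl⟩ := tpow_zero t
  simp only [TensorProduct.tmul_smul, ← TensorProduct.smul_tmul', map_smul, snocE_tprod,
    consE_tprod]
  congr 2
  ext i
  exact Fin.cases rfl (fun j => j.elim0) i

end Induction

section Mul

variable {A : Type*} [Ring A] [Algebra k A]

theorem mulAt_zero_consE (n : ℕ) (a b : A) (t : ⨂[k]^n A) :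
    mulAt k A (n + 1) 0 (consE k A (n + 1) (a ⊗ₜ consE k A n (b ⊗ₜ t))) =
      consE k A n ((a * b) ⊗ₜ t) := by
  simp [mulAt]

theorem mulAt_succ_consE (n : ℕ) (i : Fin n) (a : A) (t : ⨂[k]^(n + 1) A) :
    mulAt k A (n + 1) i.succ (consE k A (n + 1) (a ⊗ₜ t)) = consE k A n (a ⊗ₜ mulAt k A n i t) := by
  simp [mulAt]

/-- Multiplying the factors `i + 1`, `i + 2` and then `0`, `1` is the same as multiplying `0`, `1`
and then `i`, `i + 1`. -/
theorem mulAt_zero_comp_succ (n : ℕ) (i : Fin (n + 1)) (t : ⨂[k]^(n + 3) A) :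
    mulAt k A (n + 1) 0 (mulAt k A (n + 2) i.succ t) =
      mulAt k A (n + 1) i (mulAt k A (n + 2) 0 t) := by
  induction t using consE_induction with
  | add x y hx hy => simp only [map_add, hx, hy]
  | cons a t =>
    induction t using consE_induction with
    | add x y hx hy => simp only [map_add, TensorProduct.tmul_add, hx, hy]
    | cons b t =>
      refine Fin.cases ?_ (fun j => ?_) i
      · induction t using consE_induction with
        | add x y hx hy => simp only [map_add, TensorProduct.tmul_add, hx, hy]
        | cons c t => simp only [mulAt_succ_consE, mulAt_zero_consE, mul_assoc]
      · rw [mulAt_succ_consE]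
        cases n with
        | zero => exact j.elim0
        | succ n => simp only [mulAt_succ_consE, mulAt_zero_consE]

end Mul

section Comul

variable {C : Type*} [AddCommGroup C] [Module k C] [Coalgebra k C]

theorem comulAt_zero_consE (n : ℕ) (c : C) (t : ⨂[k]^n C) :
    comulAt k C (n + 1) 0 (consE k C n (c ⊗ₜ t)) =
      consE k C (n + 1) ((consE k C n).toLinearMap.lTensor C
        (TensorProduct.assoc k C C (⨂[k]^n C) (comul (R := k) c ⊗ₜ t))) := by
  simp [comulAt]

theorem comulAt_succ_consE (n : ℕ) (i : Fin n) (c : C) (t : ⨂[k]^n C) :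
    comulAt k C (n + 1) i.succ (consE k C n (c ⊗ₜ t)) =
      consE k C (n + 1) (c ⊗ₜ comulAt k C n i t) := by
  simp [comulAt]

/-- Comultiplying a factor other than the last commutes with appending a last factor. -/
theorem comulAt_castSucc_snocE (n : ℕ) (i : Fin n) (t : ⨂[k]^n C) (c : C) :
    comulAt k C (n + 1) i.castSucc (snocE k C n (t ⊗ₜ c)) =
      snocE k C (n + 1) (comulAt k C n i t ⊗ₜ c) := by
  induction n with
  | zero => exact i.elim0
  | succ n ih =>
    induction t using consE_induction with
    | add x y hx hy => simp only [map_add, TensorProduct.add_tmul, hx, hy]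
    | cons d t =>
      refine Fin.cases ?_ (fun j => ?_) i
      · rw [snocE_consE, Fin.castSucc_zero, comulAt_zero_consE, comulAt_zero_consE]
        generalize (comul (R := k) d) = w
        induction w with
        | zero => simp
        | add x y hx hy => simp only [map_add, TensorProduct.add_tmul, hx, hy]
        | tmul x y => simp [snocE_consE]
      · rw [snocE_consE, ← Fin.succ_castSucc, comulAt_succ_consE, ih, comulAt_succ_consE,
          snocE_consE]

theorem comulAt_last_snocE (n : ℕ) (t : ⨂[k]^n C) (c : C) :
    comulAt k C (n + 1) (Fin.last n) (snocE k C n (t ⊗ₜ c)) =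
      snocE k C (n + 1) ((snocE k C n).toLinearMap.rTensor C
        ((TensorProduct.assoc k (⨂[k]^n C) C C).symm (t ⊗ₜ comul (R := k) c))) := by
  induction n with
  | zero =>
    rw [snocE_zero, show Fin.last 0 = 0 from rfl, comulAt_zero_consE]
    generalize (comul (R := k) c) = w
    induction w with
    | zero => simp
    | add x y hx hy => simp only [map_add, TensorProduct.add_tmul, TensorProduct.tmul_add, hx, hy]
    | tmul x y => simp [snocE_consE, snocE_zero]
  | succ n ih =>
    induction t using consE_induction with
    | add x y hx hy => simp only [map_add, TensorProduct.add_tmul, hx, hy]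
    | cons d t =>
      rw [snocE_consE, ← Fin.succ_last, comulAt_succ_consE, ih]
      generalize (comul (R := k) c) = w
      induction w with
      | zero => simp
      | add x y hx hy => simp only [map_add, TensorProduct.tmul_add, hx, hy]
      | tmul x y => simp [snocE_consE]

end Comul

end SplitFactors

/-! ### Relations between the cofaces of the module algebra and module coalgebra complexes -/

section CofaceRelations

variable {k H M C A : Type*} [CommRing k] [Ring H] [HopfAlgebra k H]
  [AddCommGroup M] [Module k M]
  [AddCommGroup C] [Module k C] [Module H C] [IsScalarTower k H C]
  [Ring A] [Algebra k A] [Module H A] [IsScalarTower k H A]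

variable (H M) in
/-- `(h ⊗ m) ⊗ (c ⊗ d) ↦ m ⊗ (d ⊗ t ⊗ h c)`, which sends `coact m ⊗ Δ(c)` to a representative of
`∂_{n+1}(m ⊗ c ⊗ t)`. -/
def lastFaceRep {n : ℕ} (t : ⨂[k]^n C) :
    (H ⊗[k] M) ⊗[k] (C ⊗[k] C) →ₗ[k] M ⊗[k] (⨂[k]^(n + 2) C) :=
  ((consE k C (n + 1)).toLinearMap ∘ₗ
      (snocE k C n ∘ₗ TensorProduct.mk k (⨂[k]^n C) C t).lTensor C ∘ₗ
      (TensorProduct.comm k C C).toLinearMap).lTensor M ∘ₗ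
    twist (lact k H C) M C

theorem lastFaceRep_tmul {n : ℕ} (t : ⨂[k]^n C) (h : H) (m : M) (c d : C) :
    lastFaceRep H M t ((h ⊗ₜ m) ⊗ₜ (c ⊗ₜ d)) =
      m ⊗ₜ consE k C (n + 1) (d ⊗ₜ snocE k C n (t ⊗ₜ (h • c))) := by
  simp [lastFaceRep, twist_tmul]

variable [Module Hᵐᵒᵖ M] [IsScalarTower k Hᵐᵒᵖ M]

theorem CochA.ext_form {n : ℕ} {φ ψ : CochA k H M A n}
    (h : ∀ m t, CochA.form φ (m ⊗ₜ t) = CochA.form ψ (m ⊗ₜ t)) : φ = ψ :=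
  Subtype.ext (TensorProduct.ext' h)

variable [SAYDModule k H M]

section Algebra

variable [BijectiveAntipode k H] [HModuleAlgebra k H A]

theorem faceA_castSucc_form (n : ℕ) (i : Fin (n + 1)) (φ : CochA k H M A n) (m : M)
    (t : ⨂[k]^(n + 2) A) :
    CochA.form (faceA k H M A n i.castSucc φ) (m ⊗ₜ t) =
      CochA.form φ (m ⊗ₜ mulAt k A (n + 1) i t) := by
  simp only [faceA, Fin.lastCases_castSucc]
  rfl

theorem faceA_zero_form (n : ℕ) (φ : CochA k H M A n) (m : M) (t : ⨂[k]^(n + 2) A) :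
    CochA.form (faceA k H M A n 0 φ) (m ⊗ₜ t) = CochA.form φ (m ⊗ₜ mulAt k A (n + 1) 0 t) :=
  faceA_castSucc_form n 0 φ m t

/-- `(∂_{n+1}φ)(m ⊗ a ⊗ t ⊗ b) = φ(m₍₀₎ ⊗ (S⁻¹(m₍₋₁₎)b)a ⊗ t)`. -/
theorem faceA_last_form (n : ℕ) (φ : CochA k H M A n) (m : M) (a b : A) (t : ⨂[k]^n A) :
    CochA.form (faceA k H M A n (Fin.last _) φ)
        (m ⊗ₜ snocE k A (n + 1) (consE k A n (a ⊗ₜ t) ⊗ₜ b)) =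
      CochA.form φ ((consE k A n).toLinearMap.lTensor M
        ((TensorProduct.mk k A (⨂[k]^n A)).flip t |>.lTensor M
          (TensorProduct.comm k A M
            (((LinearMap.mul k A).flip a ∘ₗ (lact k H A).flip b ∘ₗ antipodeInv k H).rTensor M
              (SAYDModule.coact (k := k) (H := H) m))))) := by
  -- the last coface is `τ ∂₀`
  have key : ∀ u : H ⊗[k] M, CochA.form (faceA k H M A n 0 φ)
      ((consE k A (n + 1)).toLinearMap.lTensor M
        (twist (lact k H A ∘ₗ antipodeInv k H) M (⨂[k]^(n + 1) A)
          (u ⊗ₜ (b ⊗ₜ consE k A n (a ⊗ₜ t))))) = CochA.form φ ((consE k A n).toLinearMap.lTensor M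
        ((TensorProduct.mk k A (⨂[k]^n A)).flip t |>.lTensor M
          (TensorProduct.comm k A M
            (((LinearMap.mul k A).flip a ∘ₗ (lact k H A).flip b ∘ₗ
              antipodeInv k H).rTensor M u)))) := by
    intro u
    induction u with
    | zero => simp
    | add u v hu hv => simp only [map_add, TensorProduct.add_tmul, hu, hv]
    | tmul h m =>
      rw [twist_tmul, LinearMap.lTensor_tmul, LinearEquiv.coe_coe, faceA_zero_form,
        mulAt_zero_consE]
      simp
  rw [← key]
  simp only [faceA, Fin.lastCases_last, lastFaceA]
  rw [show (0 : Fin (n + 2)) = Fin.castSucc 0 from rfl, Fin.lastCases_castSucc]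
  change CochA.form (innerFaceA k H M A n 0 φ) (preTauA k H M A (n + 1) _) = _
  simp [preTauA]

/-- The cosimplicial identity `∂_{i+1} ∂₀ = ∂₀ ∂ᵢ`, including the last coface. The coaction occurs
once on either side of the identity for the last coface, so only associativity of the product of `A`
enters. -/
theorem faceA_succ_faceA_zero (n : ℕ) (i : Fin (n + 2)) (φ : CochA k H M A n) :
    faceA k H M A (n + 1) i.succ (faceA k H M A n 0 φ) =
      faceA k H M A (n + 1) 0 (faceA k H M A n i φ) := by
  refine CochA.ext_form fun m t => ?_
  rw [faceA_zero_form]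
  refine Fin.lastCases ?_ (fun i => ?_) i
  · induction t using snocE_induction with
    | add x y hx hy => simp only [map_add, TensorProduct.tmul_add, hx, hy]
    | snoc t c =>
      induction t using consE_induction with
      | add x y hx hy => simp only [map_add, TensorProduct.tmul_add, TensorProduct.add_tmul, hx, hy]
      | cons a t =>
        induction t using consE_induction with
        | add x y hx hy =>
          simp only [map_add, TensorProduct.tmul_add, TensorProduct.add_tmul, hx, hy]
        | cons b t =>
          rw [Fin.succ_last, faceA_last_form]
          rw [snocE_consE, snocE_consE, mulAt_zero_consE, ← snocE_consE, faceA_last_form]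
          generalize SAYDModule.coact (k := k) (H := H) m = u
          induction u with
          | zero => simp
          | add u v hu hv => simp only [map_add, hu, hv]
          | tmul h m =>
            simp only [LinearMap.rTensor_tmul, TensorProduct.comm_tmul, LinearMap.lTensor_tmul,
              LinearEquiv.coe_coe, LinearMap.flip_apply, TensorProduct.mk_apply,
              LinearMap.comp_apply, LinearMap.mul_apply', mulAt_zero_consE, faceA_zero_form,
              mul_assoc]
  · rw [Fin.succ_castSucc, faceA_castSucc_form, faceA_zero_form, faceA_castSucc_form,
      mulAt_zero_comp_succ]

end Algebra

section Coalgebra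

variable [Coalgebra k C] [HModuleCoalgebra k H C]

theorem faceC_castSucc_mk (n : ℕ) (i : Fin (n + 1)) (z : M ⊗[k] (⨂[k]^(n + 1) C)) :
    faceC k H M C n i.castSucc ((balancedRel k H M C (n + 1)).mkQ z) =
      (balancedRel k H M C (n + 2)).mkQ ((comulAt k C (n + 1) i).lTensor M z) := by
  simp only [faceC, Fin.lastCases_castSucc]
  rfl

theorem faceC_last_mk (n : ℕ) (m : M) (c : C) (t : ⨂[k]^n C) :
    faceC k H M C n (Fin.last _)
        ((balancedRel k H M C (n + 1)).mkQ (m ⊗ₜ consE k C n (c ⊗ₜ t))) =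
      (balancedRel k H M C (n + 2)).mkQ
        (lastFaceRep H M t (SAYDModule.coact (k := k) (H := H) m ⊗ₜ comul (R := k) c)) := by
  simp only [faceC, Fin.lastCases_last, lastFaceC]
  change (balancedRel k H M C (n + 2)).mkQ (preTauC k H M C (n + 1)
    (m ⊗ₜ comulAt k C (n + 1) 0 (consE k C n (c ⊗ₜ t)))) = _
  congr 1
  rw [comulAt_zero_consE]
  simp only [preTauC, LinearMap.comp_apply, TensorProduct.map_tmul, LinearEquiv.coe_coe,
    LinearEquiv.symm_apply_apply]
  generalize SAYDModule.coact (k := k) (H := H) m = u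
  generalize comul (R := k) c = w
  induction u with
  | zero => simp
  | add u v hu hv => simp only [map_add, TensorProduct.add_tmul, hu, hv]
  | tmul h m =>
    induction w with
    | zero => simp
    | add u v hu hv => simp only [map_add, TensorProduct.add_tmul, TensorProduct.tmul_add, hu, hv]
    | tmul d e => simp [lastFaceRep_tmul, twist_tmul, snocE_consE]

end Coalgebra

end CofaceRelations

section CofaceRelations

variable {k H M C : Type*} [CommRing k] [Ring H] [HopfAlgebra k H]
  [AddCommGroup M] [Module k M] [Module Hᵐᵒᵖ M]
  [AddCommGroup C] [Module k C] [Module H C] [IsScalarTower k H C]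

@[elab_as_elim]
theorem CochC.induction {n : ℕ} {p : CochC k H M C n → Prop}
    (mk : ∀ m c t, p ((balancedRel k H M C (n + 1)).mkQ (m ⊗ₜ consE k C n (c ⊗ₜ t))))
    (add : ∀ x y, p x → p y → p (x + y)) (x) : p x := by
  obtain ⟨z, rfl⟩ := (balancedRel k H M C (n + 1)).mkQ_surjective x
  induction z with
  | zero => simpa using mk 0 0 0
  | add x y hx hy => rw [map_add]; exact add _ _ hx hy
  | tmul m t =>
    induction t using consE_induction with
    | cons c t => exact mk m c t
    | add x y hx hy => rw [TensorProduct.tmul_add, map_add]; exact add _ _ hx hy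

variable [IsScalarTower k Hᵐᵒᵖ M] [SAYDModule k H M] [Coalgebra k C] [HModuleCoalgebra k H C]

/-- Coassociativity of `C`: both sides are `m₍₀₎ ⊗ c₍₂₎ ⊗ c₍₃₎ ⊗ t ⊗ m₍₋₁₎c₍₁₎`. -/
theorem faceC_castSucc_zero_faceC_last (n : ℕ) (x : CochC k H M C n) :
    faceC k H M C (n + 1) (Fin.castSucc 0) (faceC k H M C n (Fin.last _) x) =
      faceC k H M C (n + 1) (Fin.last _) (faceC k H M C n (Fin.castSucc 0) x) := by
  induction x using CochC.induction with
  | add x y hx hy => simp only [map_add, hx, hy]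
  | mk m c t =>
    -- `(h ⊗ m) ⊗ (c ⊗ (d ⊗ e)) ↦ m ⊗ (d ⊗ e ⊗ t ⊗ h c)`
    let F : (H ⊗[k] M) ⊗[k] (C ⊗[k] (C ⊗[k] C)) →ₗ[k] M ⊗[k] (⨂[k]^(n + 3) C) :=
      ((snocE k C (n + 2)).toLinearMap ∘ₗ (TensorProduct.comm k _ _).toLinearMap ∘ₗ
        ((consE k C (n + 1)).toLinearMap ∘ₗ ((consE k C n).toLinearMap ∘ₗ
          (TensorProduct.mk k C (⨂[k]^n C)).flip t).lTensor C).lTensor C).lTensor M ∘ₗ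
        twist (lact k H C) M (C ⊗[k] C)
    have hF : ∀ h m c d e, F ((h ⊗ₜ m) ⊗ₜ (c ⊗ₜ (d ⊗ₜ e))) =
        m ⊗ₜ snocE k C (n + 2) (consE k C (n + 1) (d ⊗ₜ consE k C n (e ⊗ₜ t)) ⊗ₜ (h • c)) := by
      intros; simp [F, twist_tmul]
    have h1 : ∀ (u : H ⊗[k] M) (w : C ⊗[k] C),
        (comulAt k C (n + 2) 0).lTensor M (lastFaceRep H M t (u ⊗ₜ w)) =
          F (u ⊗ₜ comul.lTensor C w) := by
      intro u w
      induction u with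
      | zero => simp
      | add u v hu hv => simp only [map_add, TensorProduct.add_tmul, hu, hv]
      | tmul h m =>
        induction w with
        | zero => simp
        | add u v hu hv => simp only [map_add, TensorProduct.tmul_add, hu, hv]
        | tmul c d =>
          rw [lastFaceRep_tmul, LinearMap.lTensor_tmul, comulAt_zero_consE, LinearMap.lTensor_tmul]
          generalize comul (R := k) d = w
          induction w with
          | zero => simp
          | add u v hu hv => simp only [map_add, TensorProduct.tmul_add, TensorProduct.add_tmul,
              hu, hv]
          | tmul d e => simp [hF, snocE_consE]
    have h2 : ∀ w : C ⊗[k] C, faceC k H M C (n + 1) (Fin.last _) ((balancedRel k H M C (n + 2)).mkQ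
        (m ⊗ₜ consE k C (n + 1) ((consE k C n).toLinearMap.lTensor C
          (TensorProduct.assoc k C C (⨂[k]^n C) (w ⊗ₜ t))))) =
        (balancedRel k H M C (n + 3)).mkQ (F (SAYDModule.coact (k := k) (H := H) m ⊗ₜ
          TensorProduct.assoc k C C C (comul.rTensor C w))) := by
      intro w
      induction w with
      | zero => simp
      | add u v hu hv => simp only [map_add, TensorProduct.tmul_add, TensorProduct.add_tmul, hu, hv]
      | tmul d e =>
        simp only [TensorProduct.assoc_tmul, LinearMap.lTensor_tmul, LinearEquiv.coe_coe,
          LinearMap.rTensor_tmul]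
        rw [faceC_last_mk]
        congr 1
        generalize SAYDModule.coact (k := k) (H := H) m = u
        generalize comul (R := k) d = w
        induction u with
        | zero => simp
        | add u v hu hv => simp only [map_add, TensorProduct.add_tmul, hu, hv]
        | tmul h m =>
          induction w with
          | zero => simp
          | add u v hu hv => simp only [map_add, TensorProduct.tmul_add, TensorProduct.add_tmul,
              hu, hv]
          | tmul c d => simp [hF, lastFaceRep_tmul, snocE_consE]
    rw [faceC_last_mk, faceC_castSucc_mk, faceC_castSucc_mk, LinearMap.lTensor_tmul,
      comulAt_zero_consE, h1, h2, coassoc_apply]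

theorem faceC_castSucc_succ_faceC_last (n : ℕ) (j : Fin n) (x : CochC k H M C n) :
    faceC k H M C (n + 1) j.succ.castSucc.castSucc (faceC k H M C n (Fin.last _) x) =
      faceC k H M C (n + 1) (Fin.last _) (faceC k H M C n j.succ.castSucc x) := by
  induction x using CochC.induction with
  | add x y hx hy => simp only [map_add, hx, hy]
  | mk m c t =>
    rw [faceC_last_mk, faceC_castSucc_mk, faceC_castSucc_mk, LinearMap.lTensor_tmul,
      comulAt_succ_consE, faceC_last_mk]
    congr 1
    generalize SAYDModule.coact (k := k) (H := H) m = u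
    generalize comul (R := k) c = w
    induction u with
    | zero => simp
    | add u v hu hv => simp only [map_add, TensorProduct.add_tmul, hu, hv]
    | tmul h m =>
      induction w with
      | zero => simp
      | add u v hu hv => simp only [map_add, TensorProduct.tmul_add, hu, hv]
      | tmul c d =>
        rw [lastFaceRep_tmul, lastFaceRep_tmul, LinearMap.lTensor_tmul, ← Fin.succ_castSucc,
          comulAt_succ_consE, comulAt_castSucc_snocE]

/-- Coassociativity of `M` and `C`, and `H`-linearity of `Δ`: both sides are
`m₍₀₎ ⊗ c₍₃₎ ⊗ t ⊗ m₍₋₂₎c₍₁₎ ⊗ m₍₋₁₎c₍₂₎`. -/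
theorem faceC_castSucc_last_faceC_last (n : ℕ) (x : CochC k H M C n) :
    faceC k H M C (n + 1) (Fin.last (n + 1)).castSucc (faceC k H M C n (Fin.last _) x) =
      faceC k H M C (n + 1) (Fin.last _) (faceC k H M C n (Fin.last _) x) := by
  induction x using CochC.induction with
  | add x y hx hy => simp only [map_add, hx, hy]
  | mk m c t =>
    -- `(h ⊗ (h' ⊗ m)) ⊗ (c ⊗ (d ⊗ e)) ↦ m ⊗ (e ⊗ t ⊗ h c ⊗ h' d)`
    let F : (H ⊗[k] (H ⊗[k] M)) ⊗[k] (C ⊗[k] (C ⊗[k] C)) →ₗ[k] M ⊗[k] (⨂[k]^(n + 3) C) :=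
      ((consE k C (n + 2)).toLinearMap ∘ₗ (TensorProduct.comm k _ _).toLinearMap ∘ₗ
        (snocE k C (n + 1)).toLinearMap.rTensor C ∘ₗ
        (TensorProduct.assoc k _ _ _).symm.toLinearMap).lTensor M ∘ₗ
        (TensorProduct.leftComm k _ _ _).toLinearMap ∘ₗ
        TensorProduct.map ((snocE k C n).toLinearMap ∘ₗ TensorProduct.mk k (⨂[k]^n C) C t ∘ₗ
          TensorProduct.lift (lact k H C)) (twist (lact k H C) M C) ∘ₗ
        (TensorProduct.tensorTensorTensorComm k _ _ _ _).toLinearMap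
    have hF : ∀ h h' m c d e, F ((h ⊗ₜ (h' ⊗ₜ m)) ⊗ₜ (c ⊗ₜ (d ⊗ₜ e))) =
        m ⊗ₜ consE k C (n + 2)
          (e ⊗ₜ snocE k C (n + 1) (snocE k C n (t ⊗ₜ (h • c)) ⊗ₜ (h' • d))) := by
      intros; simp [F, twist_tmul]
    have h1 : ∀ (u : H ⊗[k] M) (w : C ⊗[k] C),
        (comulAt k C (n + 2) (Fin.last (n + 1))).lTensor M (lastFaceRep H M t (u ⊗ₜ w)) =
          F (TensorProduct.assoc k H H M (comul.rTensor M u) ⊗ₜ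
            TensorProduct.assoc k C C C (comul.rTensor C w)) := by
      intro u w
      induction u with
      | zero => simp
      | add u v hu hv => simp only [map_add, TensorProduct.add_tmul, hu, hv]
      | tmul h m =>
        induction w with
        | zero => simp
        | add u v hu hv => simp only [map_add, TensorProduct.tmul_add, hu, hv]
        | tmul c d =>
          rw [lastFaceRep_tmul, LinearMap.lTensor_tmul, ← Fin.succ_last, comulAt_succ_consE,
            comulAt_last_snocE, HModuleCoalgebra.comul_smul, LinearMap.rTensor_tmul,
            LinearMap.rTensor_tmul]
          generalize comul (R := k) c = w
          induction w with
          | zero => simp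
          | add u v hu hv => simp only [map_add, TensorProduct.tmul_add, TensorProduct.add_tmul,
              hu, hv]
          | tmul c c' =>
            rw [tensorAct_tmul]
            generalize comul (R := k) h = v
            induction v with
            | zero => simp
            | add u v hu hv => simp only [map_add, TensorProduct.tmul_add, TensorProduct.add_tmul,
                hu, hv]
            | tmul h h' => simp [hF]
    have h2 : ∀ (u : H ⊗[k] M) (w : C ⊗[k] C),
        faceC k H M C (n + 1) (Fin.last _) ((balancedRel k H M C (n + 2)).mkQ
          (lastFaceRep H M t (u ⊗ₜ w))) = (balancedRel k H M C (n + 3)).mkQ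
        (F ((SAYDModule.coact (k := k) (H := H)).lTensor H u ⊗ₜ comul.lTensor C w)) := by
      intro u w
      induction u with
      | zero => simp
      | add u v hu hv => simp only [map_add, TensorProduct.add_tmul, hu, hv]
      | tmul h m =>
        induction w with
        | zero => simp
        | add u v hu hv => simp only [map_add, TensorProduct.tmul_add, hu, hv]
        | tmul c d =>
          rw [lastFaceRep_tmul, faceC_last_mk, LinearMap.lTensor_tmul, LinearMap.lTensor_tmul]
          congr 1
          generalize SAYDModule.coact (k := k) (H := H) m = u
          generalize comul (R := k) d = w
          induction u with
          | zero => simp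
          | add u v hu hv => simp only [map_add, TensorProduct.tmul_add, TensorProduct.add_tmul,
              hu, hv]
          | tmul h m =>
            induction w with
            | zero => simp
            | add u v hu hv => simp only [map_add, TensorProduct.tmul_add, hu, hv]
            | tmul c d => simp [hF, lastFaceRep_tmul]
    have hM := LinearMap.congr_fun (SAYDModule.coassoc (k := k) (H := H) (M := M)) m
    simp only [LinearMap.comp_apply, LinearEquiv.coe_coe] at hM
    rw [faceC_last_mk, faceC_castSucc_mk, h1, h2, coassoc_apply, hM]

/-- The cosimplicial identity `∂ᵢ ∂_{n+1} = ∂_{n+2} ∂ᵢ` for `i ≤ n + 1`. -/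
theorem faceC_castSucc_faceC_last (n : ℕ) (i : Fin (n + 2)) (x : CochC k H M C n) :
    faceC k H M C (n + 1) i.castSucc (faceC k H M C n (Fin.last _) x) =
      faceC k H M C (n + 1) (Fin.last _) (faceC k H M C n i x) := by
  refine Fin.lastCases (faceC_castSucc_last_faceC_last n x) (fun i => ?_) i
  refine Fin.cases (faceC_castSucc_zero_faceC_last n x) (fun j => ?_) i
  exact faceC_castSucc_succ_faceC_last n j x

end CofaceRelations

/-! ### Factorwise bilinear maps of tensor powers -/

section Map₂

variable {k : Type*} [CommRing k] {U V W : Type*} [AddCommGroup U] [Module k U]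
  [AddCommGroup V] [Module k V] [AddCommGroup W] [Module k W] (f : U →ₗ[k] V →ₗ[k] W)

/-- `u₁ ⊗ … ⊗ uₙ`, `v₁ ⊗ … ⊗ vₙ` go to `f(u₁, v₁) ⊗ … ⊗ f(uₙ, vₙ)`. -/
def tpowMap₂ (n : ℕ) : (⨂[k]^n U) →ₗ[k] (⨂[k]^n V) →ₗ[k] (⨂[k]^n W) :=
  PiTensorProduct.map₂ fun _ => f

theorem tpowMap₂_tprod (n : ℕ) (u : Fin n → U) (v : Fin n → V) :
    tpowMap₂ f n (PiTensorProduct.tprod k u) (PiTensorProduct.tprod k v) =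
      PiTensorProduct.tprod k fun i => f (u i) (v i) :=
  PiTensorProduct.map₂_tprod_tprod _ _ _

theorem tpowMap₂_consE (n : ℕ) (u : U) (s : ⨂[k]^n U) (v : V) (t : ⨂[k]^n V) :
    tpowMap₂ f (n + 1) (consE k U n (u ⊗ₜ s)) (consE k V n (v ⊗ₜ t)) =
      consE k W n (f u v ⊗ₜ tpowMap₂ f n s t) := by
  induction s using PiTensorProduct.induction_on with
  | add x y hx hy => simp only [map_add, TensorProduct.tmul_add, LinearMap.add_apply, hx, hy]
  | smul_tprod r s =>
    simp only [map_smul, TensorProduct.tmul_smul, LinearMap.smul_apply]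
    congr 1
    induction t using PiTensorProduct.induction_on with
    | add x y hx hy => simp only [map_add, TensorProduct.tmul_add, hx, hy]
    | smul_tprod r t =>
      simp only [map_smul, TensorProduct.tmul_smul, consE_tprod, tpowMap₂_tprod]
      congr 2
      ext i
      exact Fin.cases rfl (fun j => rfl) i

theorem tpowMap₂_snocE (n : ℕ) (s : ⨂[k]^n U) (u : U) (t : ⨂[k]^n V) (v : V) :
    tpowMap₂ f (n + 1) (snocE k U n (s ⊗ₜ u)) (snocE k V n (t ⊗ₜ v)) =
      snocE k W n (tpowMap₂ f n s t ⊗ₜ f u v) := by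
  induction s using PiTensorProduct.induction_on with
  | add x y hx hy =>
    simp only [map_add, TensorProduct.add_tmul, LinearMap.add_apply, hx, hy]
  | smul_tprod r s =>
    simp only [map_smul, ← TensorProduct.smul_tmul', LinearMap.smul_apply]
    congr 1
    induction t using PiTensorProduct.induction_on with
    | add x y hx hy => simp only [map_add, TensorProduct.add_tmul, hx, hy]
    | smul_tprod r t =>
      simp only [map_smul, ← TensorProduct.smul_tmul', snocE_tprod, tpowMap₂_tprod]
      congr 2
      ext i
      exact Fin.lastCases (by simp) (fun j => by simp) i

end Map₂

/-! ### Compatibility of the pairing with the cofaces -/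

section Psi

variable {k H M C A : Type*} [CommRing k] [Ring H] [HopfAlgebra k H]

/-- `S⁻¹(h₍₂₎) h₍₁₎ = ε(h)`. -/
theorem mul_antipodeInv_comul' [BijectiveAntipode k H] (h : H) :
    LinearMap.mul' k H ((antipodeInv k H).rTensor H (TensorProduct.comm k H H (comul h))) =
      algebraMap k H (counit (R := k) h) := by
  apply (BijectiveAntipode.bijective (k := k) (H := H)).injective
  have : antipode k (algebraMap k H (counit (R := k) h)) = algebraMap k H (counit (R := k) h) := by
    rw [Algebra.algebraMap_eq_smul_one, map_smul, antipode_one]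
  rw [this, ← mul_antipode_rTensor_comul_apply]
  generalize (comul (R := k) h) = w
  induction w with
  | zero => simp
  | tmul a b => simp [antipode_mul_antidistrib]
  | add a b ha hb => simp only [map_add, ha, hb]

variable [AddCommGroup M] [Module k M] [Ring A] [Algebra k A] [Module H A] [IsScalarTower k H A]

section Antipode

variable [BijectiveAntipode k H]

variable (k H M) in
/-- `h ⊗ (h' ⊗ m) ↦ m ⊗ (S⁻¹(h') h) a`. -/
noncomputable def antipodeInvAct (a : A) : H ⊗[k] (H ⊗[k] M) →ₗ[k] M ⊗[k] A :=
  ((lact k H A).flip a ∘ₗ LinearMap.mul' k H ∘ₗ (antipodeInv k H).rTensor H ∘ₗ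
      (TensorProduct.comm k H H).toLinearMap).lTensor M ∘ₗ
    (TensorProduct.comm k (H ⊗[k] H) M).toLinearMap ∘ₗ
    (TensorProduct.assoc k H H M).symm.toLinearMap

theorem antipodeInvAct_tmul (a : A) (h h' : H) (m : M) :
    antipodeInvAct k H M a (h ⊗ₜ (h' ⊗ₜ m)) = m ⊗ₜ ((antipodeInv k H h' * h) • a) := by
  simp [antipodeInvAct]

variable [Module Hᵐᵒᵖ M] [IsScalarTower k Hᵐᵒᵖ M] [SAYDModule k H M]

/-- `m₍₀₎ ⊗ S⁻¹(m₍₋₁₎) m₍₋₂₎ a = m ⊗ a`. -/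
theorem antipodeInvAct_coact (a : A) (m : M) :
    antipodeInvAct k H M a ((SAYDModule.coact (k := k) (H := H)).lTensor H
      (SAYDModule.coact (k := k) (H := H) m)) = m ⊗ₜ a := by
  have hM := LinearMap.congr_fun (SAYDModule.coassoc (k := k) (H := H) (M := M)) m
  have hc := LinearMap.congr_fun (SAYDModule.counit_coact (k := k) (H := H) (M := M)) m
  simp only [LinearMap.comp_apply, LinearEquiv.coe_coe, TensorProduct.mk_apply] at hM hc
  have key : ∀ u : H ⊗[k] M, antipodeInvAct k H M a
      (TensorProduct.assoc k H H M (comul.rTensor M u)) =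
      TensorProduct.lid k M (counit.rTensor M u) ⊗ₜ a := by
    intro u
    induction u with
    | zero => simp
    | add u v hu hv => simp only [map_add, TensorProduct.add_tmul, hu, hv]
    | tmul h m =>
      simp only [antipodeInvAct, LinearMap.comp_apply, LinearMap.rTensor_tmul,
        LinearEquiv.coe_coe, LinearEquiv.symm_apply_apply, TensorProduct.comm_tmul,
        LinearMap.lTensor_tmul, mul_antipodeInv_comul']
      simp [TensorProduct.smul_tmul]
  rw [← hM, key, hc, TensorProduct.lid_tmul, one_smul]

end Antipode

variable [Module Hᵐᵒᵖ M] [IsScalarTower k Hᵐᵒᵖ M]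
  [AddCommGroup C] [Module k C] [Module H C] [IsScalarTower k H C]
variable [Coalgebra k C] [CoalgebraAction k H C A]

variable (k H C A) in
/-- `a¹ ⊗ … ⊗ aⁿ`, `c¹ ⊗ … ⊗ cⁿ` go to `c¹(a¹) ⊗ … ⊗ cⁿ(aⁿ)`. -/
abbrev evalAction (n : ℕ) : (⨂[k]^n A) →ₗ[k] (⨂[k]^n C) →ₗ[k] (⨂[k]^n A) :=
  tpowMap₂ (CoalgebraAction.action (k := k) (H := H)).flip n

theorem evalHom_map_natMap (n : ℕ) (t : ⨂[k]^n A) :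
    evalHom k H C A n (PiTensorProduct.map (fun _ => natMap k H C A) t) =
      evalAction k H C A n t := by
  refine LinearMap.ext fun w => ?_
  induction t using PiTensorProduct.induction_on with
  | add x y hx hy => simp only [map_add, LinearMap.add_apply, hx, hy]
  | smul_tprod r a =>
    induction w using PiTensorProduct.induction_on with
    | add x y hx hy => simp only [map_add, hx, hy]
    | smul_tprod r c =>
      simp only [map_smul, LinearMap.smul_apply, tpowMap₂_tprod]
      simp only [evalHom, LinearMap.comp_apply, PiTensorProduct.map_tprod,
        PiTensorProduct.piTensorHomMap_tprod_tprod]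
      rfl

theorem psi_mk (n : ℕ) (φ : CochA k H M A n) (z : M ⊗[k] (⨂[k]^(n + 1) C))
    (t : ⨂[k]^(n + 1) A) :
    psi k H M C A n (φ ⊗ₜ (balancedRel k H M C (n + 1)).mkQ z) t =
      CochA.form φ ((evalAction k H C A (n + 1) t).lTensor M z) := by
  rw [← evalHom_map_natMap]
  rfl

/-- Because `c(ab) = c₍₁₎(a) c₍₂₎(b)`, evaluating `Δ` applied to the `i`-th factor and multiplying
amounts to evaluating on the product of the `i`-th and `(i+1)`-st factors. -/
theorem mulAt_evalAction (n : ℕ) (i : Fin n) (t : ⨂[k]^(n + 1) A) (w : ⨂[k]^n C) :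
    mulAt k A n i (evalAction k H C A (n + 1) t (comulAt k C n i w)) =
      evalAction k H C A n (mulAt k A n i t) w := by
  induction n with
  | zero => exact i.elim0
  | succ n ih =>
    induction t using consE_induction with
    | add x y hx hy => simp only [map_add, LinearMap.add_apply, hx, hy]
    | cons a t =>
      induction w using consE_induction with
      | add x y hx hy => simp only [map_add, hx, hy]
      | cons c w =>
        refine Fin.cases ?_ (fun j => ?_) i
        · induction t using consE_induction with
          | add x y hx hy => simp only [map_add, TensorProduct.tmul_add, LinearMap.add_apply, hx, hy]
          | cons b t =>
            rw [mulAt_zero_consE, comulAt_zero_consE, tpowMap₂_consE, LinearMap.flip_apply,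
              CoalgebraAction.action_mul]
            generalize comul (R := k) c = v
            induction v with
            | zero => simp
            | add u v hu hv => simp only [map_add, TensorProduct.add_tmul, hu, hv]
            | tmul c d => simp [tpowMap₂_consE, mulAt_zero_consE]
        · rw [mulAt_succ_consE, comulAt_succ_consE, tpowMap₂_consE, tpowMap₂_consE,
            mulAt_succ_consE, ih]

theorem face_castSucc_apply (n : ℕ) (i : Fin (n + 1)) (f : Coch k A n) (t : ⨂[k]^(n + 2) A) :
    face k A n i.castSucc f t = f (mulAt k A (n + 1) i t) := by
  simp [face]

theorem face_last_apply (n : ℕ) (f : Coch k A n) (a b : A) (t : ⨂[k]^n A) :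
    face k A n (Fin.last _) f (snocE k A (n + 1) (consE k A n (a ⊗ₜ t) ⊗ₜ b)) =
      f (consE k A n ((b * a) ⊗ₜ t)) := by
  simp [face, rot, mulAt_zero_consE]

variable [SAYDModule k H M] [BijectiveAntipode k H] [HModuleCoalgebra k H C] [HModuleAlgebra k H A]

/-- For the last cofaces the two coactions on `m` cancel, `S⁻¹(m₍₋₁₎) m₍₋₂₎ ⊗ m₍₀₎ = 1 ⊗ m`, and what
remains is `c₍₁₎(b) c₍₂₎(a) = c(ba)`. -/
theorem psi_faceA_last_faceC_last (n : ℕ) (φ : CochA k H M A n) (x : CochC k H M C n) :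
    psi k H M C A (n + 1) (faceA k H M A n (Fin.last _) φ ⊗ₜ faceC k H M C n (Fin.last _) x) =
      face k A n (Fin.last _) (psi k H M C A n (φ ⊗ₜ x)) := by
  refine LinearMap.ext fun t => ?_
  induction x using CochC.induction with
  | add x y hx hy => simp only [map_add, TensorProduct.tmul_add, LinearMap.add_apply, hx, hy]
  | mk m c w =>
    induction t using snocE_induction with
    | add x y hx hy => simp only [map_add, hx, hy]
    | snoc t b =>
      induction t using consE_induction with
      | add x y hx hy => simp only [map_add, TensorProduct.add_tmul, hx, hy]
      | cons a t =>
        rw [face_last_apply, faceC_last_mk, psi_mk, psi_mk, LinearMap.lTensor_tmul, tpowMap₂_consE,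
          LinearMap.flip_apply, CoalgebraAction.action_mul]
        generalize comul (R := k) c = v
        induction v with
        | zero => simp
        | add u v hu hv =>
          simp only [map_add, TensorProduct.tmul_add, TensorProduct.add_tmul, hu, hv]
        | tmul c d =>
          -- `m ⊗ e ↦ m ⊗ (e d(a) ⊗ w(t))`
          let N : M ⊗[k] A →ₗ[k] M ⊗[k] (⨂[k]^(n + 1) A) :=
            ((consE k A n).toLinearMap ∘ₗ
              (TensorProduct.mk k A (⨂[k]^n A)).flip (evalAction k H C A n t w) ∘ₗ
              (LinearMap.mul k A).flip
                (CoalgebraAction.action (k := k) (H := H) d a)).lTensor M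
          have hN : ∀ m e, N (m ⊗ₜ e) = m ⊗ₜ consE k A n
              ((e * CoalgebraAction.action (k := k) (H := H) d a) ⊗ₜ
                evalAction k H C A n t w) := by
            intros; simp [N]
          have key : ∀ u : H ⊗[k] M, CochA.form (faceA k H M A n (Fin.last _) φ)
              ((evalAction k H C A (n + 2)
                (snocE k A (n + 1) (consE k A n (a ⊗ₜ t) ⊗ₜ b))).lTensor M
                (lastFaceRep H M w (u ⊗ₜ (c ⊗ₜ d)))) =
              CochA.form φ (N (antipodeInvAct k H M
                (CoalgebraAction.action (k := k) (H := H) c b)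
                ((SAYDModule.coact (k := k) (H := H)).lTensor H u))) := by
            intro u
            induction u with
            | zero => simp
            | add u v hu hv => simp only [map_add, TensorProduct.add_tmul, hu, hv]
            | tmul h m =>
              rw [lastFaceRep_tmul, ← snocE_consE, LinearMap.lTensor_tmul, tpowMap₂_snocE,
                tpowMap₂_consE, faceA_last_form, LinearMap.lTensor_tmul]
              generalize SAYDModule.coact (k := k) (H := H) m = v
              induction v with
              | zero => simp
              | add u v hu hv => simp only [map_add, TensorProduct.tmul_add, hu, hv]
              | tmul h' m =>
                rw [antipodeInvAct_tmul, hN]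
                simp [mul_smul, CoalgebraAction.smul_action]
          rw [key, antipodeInvAct_coact, hN]
          simp

theorem psi_faceA_faceC (n : ℕ) (i : Fin (n + 2)) (φ : CochA k H M A n) (x : CochC k H M C n) :
    psi k H M C A (n + 1) (faceA k H M A n i φ ⊗ₜ faceC k H M C n i x) =
      face k A n i (psi k H M C A n (φ ⊗ₜ x)) := by
  refine Fin.lastCases (psi_faceA_last_faceC_last n φ x) (fun i => ?_) i
  refine LinearMap.ext fun t => ?_
  induction x using CochC.induction with
  | add x y hx hy => simp only [map_add, TensorProduct.tmul_add, LinearMap.add_apply, hx, hy]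
  | mk m c w =>
    rw [face_castSucc_apply, faceC_castSucc_mk, psi_mk, psi_mk, LinearMap.lTensor_tmul,
      LinearMap.lTensor_tmul, LinearMap.lTensor_tmul, faceA_castSucc_form, mulAt_evalAction]

theorem existsUnique_cohomology_cup (p q : ℕ) :
    ∃! cupH : HHA k H M A p →ₗ[k] HHC k H M C q →ₗ[k] HH k A (p + q),
      ∀ (φ : cocyclesA k H M A p) (x : cocyclesC k H M C q),
        ∃ h : cup k H M C A p q φ x ∈ hochCocycles k A (p + q),
          cupH (classA k H M A p φ) (classC k H M C q x) =
            classHH k A (p + q) ⟨cup k H M C A p q φ x, h⟩ :=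
  existsUnique_cohomology_pairCup (X := fun n => CochA k H M A n) (Y := fun n => CochC k H M C n)
    (Z := fun n => Coch k A n) (dX := faceA k H M A) (dY := faceC k H M C) (dZ := face k A)
    faceA_succ_faceA_zero faceC_castSucc_faceC_last
    (P := fun n => TensorProduct.curry (psi k H M C A n)) psi_faceA_faceC rfl
    (Nat.le_add_right p q) (Nat.le_add_left q p)

end Psi

/-! ### Iterated coactions -/

section CoIter

variable {k : Type*} [CommRing k] {V N : Type*} [AddCommGroup V] [Module k V]
  [AddCommGroup N] [Module k N]

/-- The iterate `n ↦ n₍₋ₚ₎ ⊗ … ⊗ n₍₋₁₎ ⊗ n₍₀₎` of a map `N → V ⊗ N`. For the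
comultiplication of a coalgebra it is `c ↦ (c₍₁₎ ⊗ … ⊗ c₍ₚ₎) ⊗ c₍ₚ₊₁₎`. -/
def coIter (ρ : N →ₗ[k] V ⊗[k] N) : ∀ p : ℕ, N →ₗ[k] (⨂[k]^p V) ⊗[k] N
  | 0 => TensorProduct.mk k (⨂[k]^0 V) N (PiTensorProduct.tprod k Fin.elim0)
  | p + 1 => (consE k V p).toLinearMap.rTensor N ∘ₗ
      (TensorProduct.assoc k V (⨂[k]^p V) N).symm.toLinearMap ∘ₗ (coIter ρ p).lTensor V ∘ₗ ρ

/-- One more application of `ρ` may also be made at the last factor. -/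
theorem coIter_succ_last (ρ : N →ₗ[k] V ⊗[k] N) (p : ℕ) (x : N) :
    coIter ρ (p + 1) x = (snocE k V p).toLinearMap.rTensor N
      ((TensorProduct.assoc k (⨂[k]^p V) V N).symm (ρ.lTensor (⨂[k]^p V) (coIter ρ p x))) := by
  induction p generalizing x with
  | zero =>
    simp only [coIter, LinearMap.comp_apply, TensorProduct.mk_apply, LinearMap.lTensor_tmul]
    generalize ρ x = u
    induction u with
    | zero => simp
    | add u v hu hv => simp only [map_add, TensorProduct.tmul_add, hu, hv]
    | tmul v y => simp [snocE_zero]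
  | succ p ih =>
    have key : ∀ u : V ⊗[k] N, (consE k V (p + 1)).toLinearMap.rTensor N
        ((TensorProduct.assoc k V (⨂[k]^(p + 1) V) N).symm ((coIter ρ (p + 1)).lTensor V u)) =
      (snocE k V (p + 1)).toLinearMap.rTensor N
      ((TensorProduct.assoc k (⨂[k]^(p + 1) V) V N).symm (ρ.lTensor (⨂[k]^(p + 1) V)
        ((consE k V p).toLinearMap.rTensor N
          ((TensorProduct.assoc k V (⨂[k]^p V) N).symm ((coIter ρ p).lTensor V u))))) := by
      intro u
      induction u with
      | zero => simp
      | add u v hu hv => simp only [map_add, hu, hv]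
      | tmul v x =>
        rw [LinearMap.lTensor_tmul, LinearMap.lTensor_tmul, ih]
        generalize coIter ρ p x = z
        induction z with
        | zero => simp
        | add u v hu hv => simp only [map_add, TensorProduct.tmul_add, hu, hv]
        | tmul s x =>
          simp only [LinearMap.lTensor_tmul, TensorProduct.assoc_symm_tmul, LinearMap.rTensor_tmul]
          generalize ρ x = w
          induction w with
          | zero => simp
          | add u v hu hv => simp only [map_add, TensorProduct.tmul_add, hu, hv]
          | tmul v' x => simp [snocE_consE]
    exact key (ρ x)

theorem coIter_of_fixed {ρ : N →ₗ[k] V ⊗[k] N} {v : V} {x : N} (h : ρ x = v ⊗ₜ x) (p : ℕ) :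
    coIter ρ p x = PiTensorProduct.tprod k (fun _ => v) ⊗ₜ x := by
  induction p with
  | zero => simp only [coIter, TensorProduct.mk_apply]; congr 2; exact Subsingleton.elim _ _
  | succ p ih =>
    simp only [coIter, LinearMap.comp_apply, h, LinearMap.lTensor_tmul, ih, LinearEquiv.coe_coe,
      TensorProduct.assoc_symm_tmul, LinearMap.rTensor_tmul, consE_tprod]
    congr 2
    ext i
    exact Fin.cases rfl (fun j => rfl) i

theorem coactIter_eq_coIter {H : Type*} [Ring H] [HopfAlgebra k H] {M : Type*} [AddCommGroup M]
    [Module k M] [Module Hᵐᵒᵖ M] [IsScalarTower k Hᵐᵒᵖ M] [SAYDModule k H M] (p : ℕ) :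
    coactIter k H M p = coIter (SAYDModule.coact (k := k) (H := H)) p := by
  induction p with
  | zero => rfl
  | succ p ih => rw [coactIter, ih, coIter]

theorem comulIter_eq_coIter {C : Type*} [AddCommGroup C] [Module k C] [Coalgebra k C] (p : ℕ)
    (c : C) : comulIter k C p c = snocE k C p (coIter (comul (R := k) (A := C)) p c) := by
  induction p generalizing c with
  | zero => simp [comulIter, coIter, snocE_zero]
  | succ p ih =>
    simp only [comulIter, coIter, LinearMap.comp_apply]
    generalize comul (R := k) c = w
    induction w with
    | zero => simp
    | add u v hu hv => simp only [map_add, hu, hv]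
    | tmul c d =>
      rw [LinearMap.lTensor_tmul, LinearMap.lTensor_tmul, ih]
      generalize coIter (comul (R := k) (A := C)) p d = z
      induction z with
      | zero => simp
      | add u v hu hv => simp only [map_add, TensorProduct.tmul_add, hu, hv]
      | tmul s x => simp [snocE_consE]

end CoIter

/-! ### The explicit formula -/

section Formula

section Concat

variable {k V : Type*} [CommRing k] [AddCommGroup V] [Module k V]

/-- The concatenation `V^{⊗n} ⊗ V^{⊗m} → V^{⊗(n+m)}`. -/
def concat (n m : ℕ) : (⨂[k]^n V) →ₗ[k] (⨂[k]^m V) →ₗ[k] (⨂[k]^(n + m) V) :=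
  TensorProduct.curry (TensorPower.mulEquiv (R := k) (M := V) (n := n) (m := m)).toLinearMap

theorem concat_tprod (n m : ℕ) (v : Fin n → V) (w : Fin m → V) :
    concat n m (PiTensorProduct.tprod k v) (PiTensorProduct.tprod k w) =
      PiTensorProduct.tprod k (Fin.append v w) := by
  rw [← TensorPower.tprod_mul_tprod]
  rfl

theorem concat_elim0 (n : ℕ) (t : ⨂[k]^n V) :
    concat n 0 t (PiTensorProduct.tprod k Fin.elim0) = t := by
  induction t using PiTensorProduct.induction_on with
  | add x y hx hy => simp only [map_add, LinearMap.add_apply, hx, hy]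
  | smul_tprod r v =>
    rw [map_smul, LinearMap.smul_apply, concat_tprod, Fin.append_elim0]
    rfl

theorem snocE_concat (n m : ℕ) (s : ⨂[k]^n V) (t : ⨂[k]^m V) (v : V) :
    snocE k V (n + m) (concat n m s t ⊗ₜ v) = concat n (m + 1) s (snocE k V m (t ⊗ₜ v)) := by
  induction s using PiTensorProduct.induction_on with
  | add x y hx hy => simp only [map_add, TensorProduct.add_tmul, LinearMap.add_apply, hx, hy]
  | smul_tprod r s =>
    simp only [map_smul, ← TensorProduct.smul_tmul', LinearMap.smul_apply]
    congr 1
    induction t using PiTensorProduct.induction_on with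
    | add x y hx hy => simp only [map_add, TensorProduct.add_tmul, hx, hy]
    | smul_tprod r t =>
      simp only [map_smul, ← TensorProduct.smul_tmul', concat_tprod, snocE_tprod]
      rw [Fin.append_snoc]

end Concat

variable {k H M C A : Type*} [CommRing k] [Ring H] [HopfAlgebra k H]
  [AddCommGroup M] [Module k M]
  [AddCommGroup C] [Module k C] [Module H C] [IsScalarTower k H C]
  [Ring A] [Algebra k A] [Module H A] [IsScalarTower k H A]

section IterLast

variable (H M) in
/-- `(g ⊗ m) ⊗ (s ⊗ c) ↦ m ⊗ (c ⊗ t ⊗ g₁s₁ ⊗ … ⊗ gₚsₚ)`, which sends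
`m₍₋ₚ₎ ⊗ … ⊗ m₍₀₎` and `c₍₁₎ ⊗ … ⊗ c₍ₚ₊₁₎` to a representative of `∂_{p+q} ⋯ ∂_{q+1}(m ⊗ c ⊗ t)`. -/
def iterLastRep {q : ℕ} (p : ℕ) (t : ⨂[k]^q C) :
    ((⨂[k]^p H) ⊗[k] M) ⊗[k] ((⨂[k]^p C) ⊗[k] C) →ₗ[k] M ⊗[k] (⨂[k]^(q + p + 1) C) :=
  ((consE k C (q + p)).toLinearMap ∘ₗ (TensorProduct.comm k _ _).toLinearMap ∘ₗ
      (concat q p t ∘ₗ TensorProduct.lift (tpowMap₂ (lact k H C) p)).rTensor C ∘ₗ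
      (TensorProduct.assoc k _ _ _).symm.toLinearMap).lTensor M ∘ₗ
    (TensorProduct.leftComm k _ _ _).toLinearMap ∘ₗ (TensorProduct.assoc k _ _ _).toLinearMap

theorem iterLastRep_tmul {q : ℕ} (p : ℕ) (t : ⨂[k]^q C) (g : ⨂[k]^p H) (m : M) (s : ⨂[k]^p C)
    (c : C) : iterLastRep H M p t ((g ⊗ₜ m) ⊗ₜ (s ⊗ₜ c)) =
      m ⊗ₜ consE k C (q + p) (c ⊗ₜ concat q p t (tpowMap₂ (lact k H C) p g s)) := by
  simp [iterLastRep]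

variable [Module Hᵐᵒᵖ M] [IsScalarTower k Hᵐᵒᵖ M] [SAYDModule k H M]
  [Coalgebra k C] [HModuleCoalgebra k H C]

/-- `∂_{q+p} ⋯ ∂_{q+1}(m ⊗ c ⊗ t) = m₍₀₎ ⊗ c₍ₚ₊₁₎ ⊗ t ⊗ m₍₋ₚ₎c₍₁₎ ⊗ … ⊗ m₍₋₁₎c₍ₚ₎`: each last coface
splits off one more factor at the right end of the iterated coaction and comultiplication. -/
theorem iterTo_faceC_last_mk {q : ℕ} (p : ℕ) (h : q ≤ q + p) (m : M) (c : C) (t : ⨂[k]^q C) :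
    iterTo (X := fun n => CochC k H M C n) (fun n => faceC k H M C n (Fin.last (n + 1))) h
        ((balancedRel k H M C (q + 1)).mkQ (m ⊗ₜ consE k C q (c ⊗ₜ t))) =
      (balancedRel k H M C (q + p + 1)).mkQ (iterLastRep H M p t
        (coIter (SAYDModule.coact (k := k) (H := H)) p m ⊗ₜ coIter (comul (R := k)) p c)) := by
  induction p with
  | zero =>
    refine (iterTo_self _ q _).trans ?_
    simp only [coIter, TensorProduct.mk_apply, iterLastRep_tmul]
    rw [tpowMap₂_tprod, show (fun i : Fin 0 => lact k H C (Fin.elim0 i) (Fin.elim0 i)) =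
      Fin.elim0 from Subsingleton.elim _ _, concat_elim0]
    rfl
  | succ p ih =>
    refine (iterTo_succ _ (Nat.le_add_right q p) _ _).trans ?_
    rw [ih, coIter_succ_last, coIter_succ_last]
    generalize coIter (SAYDModule.coact (k := k) (H := H) (M := M)) p m = u
    generalize coIter (comul (R := k) (A := C)) p c = w
    induction u with
    | zero => simp
    | add u v hu hv => simp only [map_add, TensorProduct.add_tmul, hu, hv]
    | tmul g m =>
      induction w with
      | zero => simp
      | add u v hu hv => simp only [map_add, TensorProduct.tmul_add, hu, hv]
      | tmul s c =>
        rw [iterLastRep_tmul, faceC_last_mk, LinearMap.lTensor_tmul, LinearMap.lTensor_tmul]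
        generalize SAYDModule.coact (k := k) (H := H) m = u
        generalize comul (R := k) c = w
        congr 1
        induction u with
        | zero => simp
        | add u v hu hv => simp only [map_add, TensorProduct.tmul_add, TensorProduct.add_tmul,
            hu, hv]
        | tmul h m =>
          induction w with
          | zero => simp
          | add u v hu hv => simp only [map_add, TensorProduct.tmul_add, hu, hv]
          | tmul c d =>
            simp only [TensorProduct.assoc_symm_tmul, LinearMap.rTensor_tmul, LinearEquiv.coe_coe]
            rw [lastFaceRep_tmul, iterLastRep_tmul, tpowMap₂_snocE, ← snocE_concat]
            rfl

end IterLast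

variable [Module Hᵐᵒᵖ M] [IsScalarTower k Hᵐᵒᵖ M] [SAYDModule k H M]

section IterFirst

variable [BijectiveAntipode k H] [HModuleAlgebra k H A]

theorem mulAt_zero_tprod (n : ℕ) (a : Fin (n + 2) → A) :
    mulAt k A (n + 1) 0 (PiTensorProduct.tprod k a) =
      PiTensorProduct.tprod k (Fin.cons (a 0 * a 1) (fun i : Fin n => a i.succ.succ) :
        Fin (n + 1) → A) := by
  rw [← consE_tprod, ← mulAt_zero_consE, consE_tprod, consE_tprod]
  congr 2
  ext i
  refine Fin.cases rfl (fun j => ?_) i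
  exact Fin.cases rfl (fun j => rfl) j

/-- `((∂₀)^q φ)(m ⊗ a⁰ ⊗ … ⊗ aⁿ) = φ(m ⊗ a⁰ ⋯ a^q ⊗ a^{q+1} ⊗ … ⊗ aⁿ)`. -/
theorem iterTo_faceA_zero_form {p q n : ℕ} (hn : n = p + q) (h : p ≤ n) (φ : CochA k H M A p)
    (m : M) (a : Fin (n + 1) → A) :
    CochA.form (iterTo (X := fun n => CochA k H M A n) (fun n => faceA k H M A n 0) h φ)
        (m ⊗ₜ PiTensorProduct.tprod k a) =
      CochA.form φ (m ⊗ₜ PiTensorProduct.tprod k (Fin.cons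
        (a 0 * (List.ofFn fun l : Fin q => a ⟨l + 1, by omega⟩).prod)
        (fun l : Fin p => a ⟨q + 1 + l, by omega⟩) : Fin (p + 1) → A)) := by
  induction q generalizing n with
  | zero =>
    obtain rfl : n = p := hn
    rw [iterTo_self (X := fun n => CochA k H M A n)]
    congr 3
    ext i
    refine Fin.cases (by simp) (fun j => ?_) i
    simp only [Fin.cons_succ]
    congr 1
    ext
    simp [add_comm]
  | succ q ih =>
    obtain ⟨n, rfl⟩ : ∃ l, n = l + 1 := ⟨p + q, hn⟩
    rw [iterTo_succ (X := fun n => CochA k H M A n) _ (show p ≤ n by omega) h, faceA_zero_form,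
      mulAt_zero_tprod, ih (by omega) (by omega)]
    congr 3
    ext i
    refine Fin.cases ?_ (fun j => ?_) i
    · simp only [Fin.cons_zero, List.ofFn_succ, List.prod_cons, mul_assoc]
      rfl
    · simp only [Fin.cons_succ]
      rw [show (⟨q + 1 + j, by omega⟩ : Fin (n + 1)) = Fin.succ ⟨q + j, by omega⟩ from
        Fin.ext (by simp; omega), Fin.cons_succ]
      congr 1
      ext
      simp
      omega

end IterFirst

variable [BijectiveAntipode k H] [HModuleAlgebra k H A]
  [Coalgebra k C] [HModuleCoalgebra k H C] [CoalgebraAction k H C A]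

/-- The value on `tprod a` of the cup product of `φ` with `m ⊗ c⁰ ⊗ … ⊗ c^q`, for Sweedler
decompositions `y` of `c⁰` and `g`, `n` of `m`. The total degree `N` is a variable because
`∂_{p+q} ⋯ ∂_{q+1}` is computed in degree `q + p`, whereas the cup product lives in degree `p + q`. -/
theorem psi_iterTo_tensC_tprod {p q N : ℕ} (hN : N = q + p) (hp : p ≤ N) (hq : q ≤ N)
    (φ : CochA k H M A p) (m : M) (c : Fin (q + 1) → C) (a : Fin (N + 1) → A) {r s : ℕ}
    {y : Fin r → Fin (p + 1) → C} {g : Fin s → Fin p → H} {n : Fin s → M}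
    (hy : comulIter k C p (c 0) = ∑ i, PiTensorProduct.tprod k (y i))
    (hg : coactIter k H M p m = ∑ j, PiTensorProduct.tprod k (g j) ⊗ₜ[k] n j) :
    psi k H M C A N (iterTo (X := fun n => CochA k H M A n) (fun n => faceA k H M A n 0) hp φ ⊗ₜ
        iterTo (X := fun n => CochC k H M C n) (fun n => faceC k H M C n (Fin.last (n + 1))) hq
          (tensC k H M C q m c)) (PiTensorProduct.tprod k a) =
      ∑ j, ∑ i, CochA.form φ
        (n j ⊗ₜ[k] PiTensorProduct.tprod k
          (Fin.cons
            (CoalgebraAction.action (k := k) (H := H) (y i (Fin.last p)) (a ⟨0, by omega⟩) *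
              (List.ofFn fun l : Fin q =>
                CoalgebraAction.action (k := k) (H := H) (c l.succ) (a ⟨l + 1, by omega⟩)).prod)
            (fun l : Fin p =>
              CoalgebraAction.action (k := k) (H := H) (g j l • y i l.castSucc)
                (a ⟨q + 1 + l, by omega⟩)) : Fin (p + 1) → A)) := by
  have hy' : coIter (comul (R := k) (A := C)) p (c 0) =
      ∑ i, PiTensorProduct.tprod k (Fin.init (y i)) ⊗ₜ y i (Fin.last p) := by
    apply (snocE k C p).injective
    rw [← comulIter_eq_coIter, hy, map_sum]
    simp only [snocE_tprod, Fin.snoc_init_self]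
  rw [coactIter_eq_coIter] at hg
  subst hN
  have hc : tensC k H M C q m c = (balancedRel k H M C (q + 1)).mkQ
      (m ⊗ₜ consE k C q (c 0 ⊗ₜ PiTensorProduct.tprod k (Fin.tail c))) := by
    rw [consE_tprod, Fin.cons_self_tail]
    rfl
  rw [hc, iterTo_faceC_last_mk, psi_mk, hg, hy', TensorProduct.sum_tmul]
  simp only [TensorProduct.tmul_sum, map_sum]
  refine Finset.sum_congr rfl fun j _ => Finset.sum_congr rfl fun i _ => ?_
  rw [iterLastRep_tmul, tpowMap₂_tprod, concat_tprod, consE_tprod, LinearMap.lTensor_tmul,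
    tpowMap₂_tprod, iterTo_faceA_zero_form (Nat.add_comm q p)]
  congr 3
  ext l
  refine Fin.cases ?_ (fun l => ?_) l
  · simp only [Fin.cons_zero, LinearMap.flip_apply]
    congr 3
    ext l
    rw [show (⟨l + 1, by omega⟩ : Fin (q + p + 1)) = (Fin.castAdd p l).succ from rfl,
      Fin.cons_succ, Fin.append_left]
    rfl
  · simp only [Fin.cons_succ, LinearMap.flip_apply]
    rw [show (⟨q + 1 + l, by omega⟩ : Fin (q + p + 1)) = (Fin.natAdd q l).succ from
      Fin.ext (by simp; omega), Fin.cons_succ, Fin.append_right]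
    rfl

end Formula

end HopfCyclic

/-! ### The cup product -/

theorem mainTheorem3 {k H M C A : Type*} [Field k] [Ring H] [HopfAlgebra k H]
    [HopfCyclic.BijectiveAntipode k H]
    [AddCommGroup M] [Module k M] [Module Hᵐᵒᵖ M] [IsScalarTower k Hᵐᵒᵖ M]
    [HopfCyclic.SAYDModule k H M]
    [AddCommGroup C] [Module k C] [Coalgebra k C] [Module H C] [IsScalarTower k H C]
    [HopfCyclic.HModuleCoalgebra k H C]
    [Ring A] [Algebra k A] [Module H A] [IsScalarTower k H A] [HopfCyclic.HModuleAlgebra k H A]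
    [HopfCyclic.CoalgebraAction k H C A] (p q : ℕ) :
    -- the cup product of cochains induces the cup product on Hochschild cohomology
    (∃! cupH : HopfCyclic.HHA k H M A p →ₗ[k] HopfCyclic.HHC k H M C q →ₗ[k]
        HopfCyclic.HH k A (p + q),
      ∀ (φ : HopfCyclic.cocyclesA k H M A p) (x : HopfCyclic.cocyclesC k H M C q),
        ∃ h : HopfCyclic.cup k H M C A p q φ x ∈ HopfCyclic.hochCocycles k A (p + q),
          cupH (HopfCyclic.classA k H M A p φ) (HopfCyclic.classC k H M C q x) =
            HopfCyclic.classHH k A (p + q) ⟨HopfCyclic.cup k H M C A p q φ x, h⟩) ∧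
    -- the explicit formula, with the Sweedler components written out
    (∀ (φ : HopfCyclic.CochA k H M A p) (m : M) (c : Fin (q + 1) → C) (a : Fin (p + q + 1) → A)
        (r s : ℕ) (y : Fin r → Fin (p + 1) → C) (g : Fin s → Fin p → H) (n : Fin s → M),
        HopfCyclic.comulIter k C p (c 0) = ∑ i, PiTensorProduct.tprod k (y i) →
        HopfCyclic.coactIter k H M p m = ∑ j, PiTensorProduct.tprod k (g j) ⊗ₜ[k] n j →
        HopfCyclic.cup k H M C A p q φ (HopfCyclic.tensC k H M C q m c)
            (PiTensorProduct.tprod k a) =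
          ∑ j, ∑ i, HopfCyclic.CochA.form φ
            (n j ⊗ₜ[k] PiTensorProduct.tprod k
              (Fin.cons
                (HopfCyclic.CoalgebraAction.action (k := k) (H := H) (y i (Fin.last p))
                    (a ⟨0, by omega⟩) *
                  (List.ofFn fun l : Fin q =>
                    HopfCyclic.CoalgebraAction.action (k := k) (H := H) (c l.succ)
                      (a ⟨l + 1, by omega⟩)).prod)
                (fun l : Fin p =>
                  HopfCyclic.CoalgebraAction.action (k := k) (H := H) (g j l • y i l.castSucc)
                    (a ⟨q + 1 + l, by omega⟩)) : Fin (p + 1) → A))) ∧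
    -- the formula when `m` is coinvariant
    (∀ (φ : HopfCyclic.CochA k H M A p) (m : M) (c : Fin (q + 1) → C) (a : Fin (p + q + 1) → A)
        (r : ℕ) (y : Fin r → Fin (p + 1) → C),
        HopfCyclic.SAYDModule.coact (k := k) (H := H) m = 1 ⊗ₜ[k] m →
        HopfCyclic.comulIter k C p (c 0) = ∑ i, PiTensorProduct.tprod k (y i) →
        HopfCyclic.cup k H M C A p q φ (HopfCyclic.tensC k H M C q m c)
            (PiTensorProduct.tprod k a) =
          ∑ i, HopfCyclic.CochA.form φ
            (m ⊗ₜ[k] PiTensorProduct.tprod k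
              (Fin.cons
                (HopfCyclic.CoalgebraAction.action (k := k) (H := H) (y i (Fin.last p))
                    (a ⟨0, by omega⟩) *
                  (List.ofFn fun l : Fin q =>
                    HopfCyclic.CoalgebraAction.action (k := k) (H := H) (c l.succ)
                      (a ⟨l + 1, by omega⟩)).prod)
                (fun l : Fin p =>
                  HopfCyclic.CoalgebraAction.action (k := k) (H := H) (y i l.castSucc)
                    (a ⟨q + 1 + l, by omega⟩)) : Fin (p + 1) → A))) := by
  refine ⟨HopfCyclic.existsUnique_cohomology_cup p q, ?_, ?_⟩
  · intro φ m c a r s y g n hy hg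
    exact HopfCyclic.psi_iterTo_tensC_tprod (Nat.add_comm p q) _ _ φ m c a hy hg
  · intro φ m c a r y hm hy
    -- for coinvariant `m` the iterated coaction is the single tensor `1 ⊗ … ⊗ 1 ⊗ m`
    have h := HopfCyclic.psi_iterTo_tensC_tprod (H := H) (Nat.add_comm p q) (Nat.le_add_right p q)
      (Nat.le_add_left q p) φ m c a hy (s := 1) (g := fun _ _ => 1) (n := fun _ => m)
      (by rw [HopfCyclic.coactIter_eq_coIter, HopfCyclic.coIter_of_fixed hm]; simp)
    refine Eq.trans h ?_
    simp only [Finset.univ_unique, Finset.sum_singleton, one_smul]
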